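/- A rectilinear drawing of the complete graph $K_n$ is a placement of its $n$ vertices at distinct points of the plane, every two of them joined by a straight line segment (an edge), such that no three vertices are collinear and no three edges have a point in common unless that point is an endpoint of all three. Its number of edge crossings is the number of unordered pairs of distinct edges that have a common interior point. Let $\overline{cr}(K_n)$, the rectilinear crossing number of $K_n$, be the smallest number of edge crossings over all rectilinear drawings of $K_n$. Then the limit of $\overline{cr}(K_n)/\binom{n}{4}$ as $n\to\infty$ exists, and $$\lim_{n\to\infty}\frac{\overline{cr}(K_n)}{\binom{n}{4}}\;\le\;\frac{6467}{16848}\approx 0.3838 .$$ -/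

import Mathlib

open Filter Topology

/-- The set of points of the plane that carry an edge `e = s(i, j)` of the complete graph on
`Fin n`, when vertex `v` is placed at `p v`: the closed line segment from `p i` to `p j`. -/
def edgeSegment {n : ℕ} (p : Fin n → EuclideanSpace ℝ (Fin 2)) (e : Sym2 (Fin n)) :
    Set (EuclideanSpace ℝ (Fin 2)) :=
  Sym2.lift ⟨fun i j => segment ℝ (p i) (p j), fun i j => segment_symm ℝ (p i) (p j)⟩ e

/-- The edge `e` without its two endpoints: the open line segment. -/
def edgeInterior {n : ℕ} (p : Fin n → EuclideanSpace ℝ (Fin 2)) (e : Sym2 (Fin n)) :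
    Set (EuclideanSpace ℝ (Fin 2)) :=
  Sym2.lift ⟨fun i j => openSegment ℝ (p i) (p j), fun i j => openSegment_symm ℝ (p i) (p j)⟩ e

/-- A placement `p` of `n` vertices in the plane gives a rectilinear drawing of `K_n` if the
vertices are distinct points, no three vertices are collinear, and no three edges have a point
in common unless that point is an endpoint of all three. -/
structure IsRectilinearDrawing {n : ℕ} (p : Fin n → EuclideanSpace ℝ (Fin 2)) : Prop where
  injective : Function.Injective p
  not_collinear : ∀ i j k : Fin n, i ≠ j → i ≠ k → j ≠ k → ¬ Collinear ℝ {p i, p j, p k}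
  not_concurrent : ∀ e ∈ (⊤ : SimpleGraph (Fin n)).edgeSet, ∀ f ∈ (⊤ : SimpleGraph (Fin n)).edgeSet,
    ∀ g ∈ (⊤ : SimpleGraph (Fin n)).edgeSet, e ≠ f → e ≠ g → f ≠ g →
    ∀ x, x ∈ edgeSegment p e → x ∈ edgeSegment p f → x ∈ edgeSegment p g →
      (∃ v ∈ e, p v = x) ∧ (∃ v ∈ f, p v = x) ∧ (∃ v ∈ g, p v = x)

/-- The number of edge crossings of a drawing: the number of unordered pairs of distinct edges
that have a common point in their interiors. -/
noncomputable def crossings {n : ℕ} (p : Fin n → EuclideanSpace ℝ (Fin 2)) : ℕ :=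
  Set.ncard {s : Sym2 (Sym2 (Fin n)) |
    ∃ e ∈ (⊤ : SimpleGraph (Fin n)).edgeSet, ∃ f ∈ (⊤ : SimpleGraph (Fin n)).edgeSet,
      e ≠ f ∧ (edgeInterior p e ∩ edgeInterior p f).Nonempty ∧ s = s(e, f)}

/-- The rectilinear crossing number of `K_n`: the fewest number of edge crossings over all
rectilinear drawings of `K_n`. -/
noncomputable def rectilinearCrossingNumber (n : ℕ) : ℕ :=
  sInf {c : ℕ | ∃ p : Fin n → EuclideanSpace ℝ (Fin 2),
    IsRectilinearDrawing p ∧ crossings p = c}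

/-!
The limit exists because the proportion `cr(n) / C(n, 4)` is bounded and does not decrease: an
optimal drawing of `K_(n+1)` contains `n + 1` drawings of `K_n`, and each crossing survives in
`n - 3` of them (`succ_mul_rectilinearCrossingNumber_le`).

For the bound, call the difference between the numbers of points on the two sides of the directed
line `xy` its defect. Call a pair among four points separating if its line separates the other two.
Four points have either one crossing and two separating pairs, or no crossing and three separating
pairs. Summed over all quadruples this gives
`8 * crossings = ∑ x, ∑ y, defect x y ^ 2 - n (n - 1) (n - 2)`
(`crossCount_eq_energy`, `eight_mul_crossings`), so a good drawing is one whose lines nearly halve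
it.

Take six points `b i` with three crossings, and for each `i` a target `f i` such that the line from
`b i` to `b (f i)` halves the other four, where `f` has no 2-cycle. Replace each `b i` by a tiny,
very flat copy of an optimal drawing of `K_m`, `m` even, along that line, so that the line through
two points of cluster `i` halves all the other clusters together, bisecting cluster `f i`
(`exists_isBlowUp`). Then lines inside a cluster have the same defect as in the drawing of `K_m`. A
line between clusters `i` and `j` has defect `m * defect b i j ± r ± r'`, where `r` and `r'` are the
rank differences of its two points in their clusters; the mean square of these is
`m ^ 2 * defect b i j ^ 2` plus two terms of at most `m ^ 2 / 3`, all mixed terms averaging to zero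
(`IsBlowUp.energy_le`). Hence `24 cr(6m) ≤ 144 cr(m) + 492 m ^ 4 + O(m ^ 3)`, and the limit `L`
satisfies `1296 L ≤ 6 L + 492`, that is `L ≤ 82 / 215 < 6467 / 16848`.

The blow-up only has to avoid collinear triples: a generic perturbation keeps all orientations and
removes concurrent edges (`GenPos.exists_drawing`).
-/

/-! ### Orientations and signs -/

/-- Twice the signed area of the triangle `abc`: positive exactly when `a`, `b`, `c` are in
counterclockwise order. -/
def orient (a b c : EuclideanSpace ℝ (Fin 2)) : ℝ :=
  (b 0 - a 0) * (c 1 - a 1) - (b 1 - a 1) * (c 0 - a 0)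

/-- The sign of a real number, as an integer. -/
noncomputable def sgn (r : ℝ) : ℤ := (SignType.sign r : ℤ)

theorem sgn_mul (a b : ℝ) : sgn (a * b) = sgn a * sgn b := by
  simp [sgn, sign_mul]

theorem sgn_pos {a : ℝ} (h : 0 < a) : sgn a = 1 := by simp [sgn, _root_.sign_pos h]

theorem sgn_neg {a : ℝ} (h : a < 0) : sgn a = -1 := by simp [sgn, _root_.sign_neg h]

theorem sgn_zero : sgn 0 = 0 := by simp [sgn]

theorem sgn_cases (a : ℝ) :
    (a < 0 ∧ sgn a = -1) ∨ (a = 0 ∧ sgn a = 0) ∨ (0 < a ∧ sgn a = 1) := by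
  rcases lt_trichotomy a 0 with h | h | h
  · exact Or.inl ⟨h, sgn_neg h⟩
  · exact Or.inr (Or.inl ⟨h, by rw [h, sgn_zero]⟩)
  · exact Or.inr (Or.inr ⟨h, sgn_pos h⟩)

theorem sgn_neg_eq (a : ℝ) : sgn (-a) = -sgn a := by
  rcases sgn_cases a with ⟨h, e⟩ | ⟨h, e⟩ | ⟨h, e⟩
  · rw [e, sgn_pos (by linarith)]; rfl
  · rw [h]; simp [sgn_zero]
  · rw [e, sgn_neg (by linarith)]

theorem sgn_eq_zero {a : ℝ} : sgn a = 0 ↔ a = 0 := by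
  rcases sgn_cases a with ⟨h, e⟩ | ⟨h, e⟩ | ⟨h, e⟩
  · simp [e, h.ne]
  · rw [e]; simp [h]
  · simp [e, h.ne']

theorem sgn_eq_neg_one {a : ℝ} : sgn a = -1 ↔ a < 0 := by
  rcases sgn_cases a with ⟨h, e⟩ | ⟨h, e⟩ | ⟨h, e⟩
  · simp [e, h]
  · rw [e]; simp [h]
  · simp [e, h.le]

theorem sgn_sq {a : ℝ} (h : a ≠ 0) : sgn a * sgn a = 1 := by
  rcases sgn_cases a with ⟨h', e⟩ | ⟨h', e⟩ | ⟨h', e⟩ <;> simp_all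

theorem sgn_intCast (z : ℤ) : sgn (z : ℝ) = z.sign := by
  rcases lt_trichotomy z 0 with h | h | h
  · rw [sgn_neg (by exact_mod_cast h), Int.sign_eq_neg_one_of_neg h]
  · simp [h, sgn_zero]
  · rw [sgn_pos (by exact_mod_cast h), Int.sign_eq_one_of_pos h]

/-- The orientation signs (the chirotope) of a placement of points. -/
noncomputable def chi {ι : Type*} (p : ι → EuclideanSpace ℝ (Fin 2)) (i j k : ι) : ℤ :=
  sgn (orient (p i) (p j) (p k))

/-- No three points of the placement are collinear; in particular, as soon as there are three
points, they are distinct. -/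
def GenPos {ι : Type*} (p : ι → EuclideanSpace ℝ (Fin 2)) : Prop :=
  ∀ i j k, i ≠ j → i ≠ k → j ≠ k → orient (p i) (p j) (p k) ≠ 0

section chi

variable {ι : Type*} (p : ι → EuclideanSpace ℝ (Fin 2))

theorem chi_swap (i j k : ι) : chi p j i k = -chi p i j k := by
  unfold chi; rw [← sgn_neg_eq]; congr 1; unfold orient; ring

theorem chi_rotate (i j k : ι) : chi p j k i = chi p i j k := by
  unfold chi; congr 1; unfold orient; ring

theorem chi_swap_right (i j k : ι) : chi p i k j = -chi p i j k := by
  rw [chi_rotate p j i k, chi_swap]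

theorem chi_self_left (i k : ι) : chi p i i k = 0 := by
  have := chi_swap p i i k; omega

theorem chi_self_right (i k : ι) : chi p i k k = 0 := by
  have := chi_swap_right p i k k; omega

theorem chi_self_outer (i k : ι) : chi p i k i = 0 := by
  rw [chi_rotate p i i k, chi_self_left]

variable {p}

theorem GenPos.chi_ne_zero (hp : GenPos p) {i j k : ι} (hij : i ≠ j) (hik : i ≠ k)
    (hjk : j ≠ k) : chi p i j k ≠ 0 := fun h => hp i j k hij hik hjk (sgn_eq_zero.1 h)

theorem GenPos.chi_eq (hp : GenPos p) {i j k : ι} (hij : i ≠ j) (hik : i ≠ k)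
    (hjk : j ≠ k) : chi p i j k = 1 ∨ chi p i j k = -1 := by
  have h := hp.chi_ne_zero hij hik hjk
  rcases sgn_cases (orient (p i) (p j) (p k)) with ⟨_, e⟩ | ⟨_, e⟩ | ⟨_, e⟩
  · exact Or.inr e
  · exact absurd e h
  · exact Or.inl e

theorem GenPos.of_chi_eq {q : ι → EuclideanSpace ℝ (Fin 2)} (hp : GenPos p)
    (h : ∀ i j k, chi q i j k = chi p i j k) : GenPos q := fun i j k hij hik hjk h0 =>
  hp.chi_ne_zero hij hik hjk (by rw [← h]; exact sgn_eq_zero.2 h0)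

end chi

/-! ### Crossings and halving defects -/

section counting

variable {ι : Type*} (p : ι → EuclideanSpace ℝ (Fin 2))

/-- The segments `xy` and `zw` cross, in terms of orientations: `z`, `w` are strictly on different
sides of the line `xy`, and `x`, `y` are strictly on different sides of the line `zw`. -/
def Cross (x y z w : ι) : Prop :=
  chi p x y z * chi p x y w = -1 ∧ chi p z w x * chi p z w y = -1

noncomputable instance (x y z w : ι) : Decidable (Cross p x y z w) := by
  unfold Cross; infer_instance

variable {p}

theorem Cross.distinct {x y z w : ι} (hc : Cross p x y z w) :
    x ≠ y ∧ x ≠ z ∧ x ≠ w ∧ y ≠ z ∧ y ≠ w ∧ z ≠ w := by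
  obtain ⟨h1, h2⟩ := hc
  refine ⟨?_, ?_, ?_, ?_, ?_, ?_⟩ <;> rintro rfl
  · rw [chi_self_left] at h1; omega
  · rw [chi_self_outer] at h1; omega
  · rw [chi_self_outer p x y] at h1; omega
  · rw [chi_self_right] at h1; omega
  · rw [chi_self_right p x y] at h1; omega
  · rw [chi_self_left] at h2; omega

variable (p)

/-- Four points in convex position have one crossing and two pairs whose line separates the other
two points; other quadruples have no crossing and three such pairs. Here this is summed over the three ways to split the four
points into two pairs. The terms for coinciding points vanish. -/
theorem chi_four_point [DecidableEq ι] (hp : GenPos p) (x y z w : ι) :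
    ((if z = w then 0 else chi p x y z * chi p x y w)
      + (if x = y then 0 else chi p z w x * chi p z w y))
    + ((if w = y then 0 else chi p x z w * chi p x z y)
      + (if x = z then 0 else chi p w y x * chi p w y z))
    + ((if y = z then 0 else chi p x w y * chi p x w z)
      + (if x = w then 0 else chi p y z x * chi p y z w))
    = 2 * ((if Cross p x y z w then 1 else 0) + (if Cross p x z w y then 1 else 0)
      + (if Cross p x w y z then 1 else 0)) := by
  by_cases hd : x ≠ y ∧ x ≠ z ∧ x ≠ w ∧ y ≠ z ∧ y ≠ w ∧ z ≠ w
  · obtain ⟨hxy, hxz, hxw, hyz, hyw, hzw⟩ := hd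
    have hsum : orient (p y) (p z) (p w) - orient (p x) (p z) (p w) + orient (p x) (p y) (p w)
        - orient (p x) (p y) (p z) = 0 := by unfold orient; ring
    have e1 : chi p z w x = chi p x z w := (chi_rotate p x z w)
    have e2 : chi p z w y = chi p y z w := (chi_rotate p y z w)
    have e3 : chi p x z y = -chi p x y z := chi_swap_right p x y z
    have e4 : chi p w y x = -chi p x y w := by rw [chi_swap, chi_rotate]
    have e5 : chi p w y z = chi p y z w := (chi_rotate p w y z).symm
    have e6 : chi p x w y = -chi p x y w := chi_swap_right p x y w
    have e7 : chi p x w z = -chi p x z w := chi_swap_right p x z w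
    have e8 : chi p y z x = chi p x y z := chi_rotate p x y z
    simp only [Cross, if_neg hxy, if_neg hxz, if_neg hxw, if_neg hyz, if_neg hyw.symm, if_neg hzw,
      e1, e2, e3, e4, e5, e6, e7, e8]
    have hA := hp y z w hyz hyw hzw
    have hB := hp x z w hxz hxw hzw
    have hC := hp x y w hxy hxw hyw
    have hD := hp x y z hxy hxz hyz
    unfold chi
    rcases sgn_cases (orient (p y) (p z) (p w)) with ⟨a, ea⟩ | ⟨a, ea⟩ | ⟨a, ea⟩ <;>
    first
    | exact absurd a hA
    | (rcases sgn_cases (orient (p x) (p z) (p w)) with ⟨b, eb⟩ | ⟨b, eb⟩ | ⟨b, eb⟩ <;>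
        first
        | exact absurd b hB
        | (rcases sgn_cases (orient (p x) (p y) (p w)) with ⟨c, ec⟩ | ⟨c, ec⟩ | ⟨c, ec⟩ <;>
            first
            | exact absurd c hC
            | (rcases sgn_cases (orient (p x) (p y) (p z)) with ⟨d, ed⟩ | ⟨d, ed⟩ | ⟨d, ed⟩ <;>
                first
                | exact absurd d hD
                | (exfalso; linarith)
                | (rw [ea, eb, ec, ed]; rfl))))
  · have n1 : ¬ Cross p x y z w := fun h => hd h.distinct
    have n2 : ¬ Cross p x z w y := fun h => by
      have := h.distinct; exact hd ⟨this.2.2.1, this.1, this.2.1, this.2.2.2.2.1.symm,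
        this.2.2.2.2.2.symm, this.2.2.2.1⟩
    have n3 : ¬ Cross p x w y z := fun h => by
      have := h.distinct; exact hd ⟨this.2.1, this.2.2.1, this.1, this.2.2.2.2.2,
        this.2.2.2.1.symm, this.2.2.2.2.1.symm⟩
    rw [if_neg n1, if_neg n2, if_neg n3]
    by_cases hxy : x = y
    · subst hxy; simp [chi_self_left, chi_self_outer, chi_self_right]
    by_cases hxz : x = z
    · subst hxz; simp [chi_self_left, chi_self_outer, chi_self_right]
    by_cases hxw : x = w
    · subst hxw; simp [chi_self_left, chi_self_outer, chi_self_right]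
    by_cases hyz : y = z
    · subst hyz; simp [chi_self_left, chi_self_outer, chi_self_right]
    by_cases hyw : y = w
    · subst hyw; simp [chi_self_left, chi_self_outer, chi_self_right]
    by_cases hzw : z = w
    · subst hzw; simp [chi_self_left, chi_self_outer, chi_self_right]
    exact absurd ⟨hxy, hxz, hxw, hyz, hyw, hzw⟩ hd

variable [Fintype ι]

/-- The number of ordered quadruples `(x, y, z, w)` for which the segments `xy` and `zw` cross. -/
noncomputable def crossCount : ℤ :=
  ∑ x, ∑ y, ∑ z, ∑ w, if Cross p x y z w then 1 else 0

/-- The number of points to the left of the directed line `xy` minus the number of points to its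
right. -/
noncomputable def defect (x y : ι) : ℤ := ∑ z, chi p x y z

/-- The sum of the squares of the defects of all directed lines through two points. -/
noncomputable def energy : ℤ := ∑ x, ∑ y, defect p x y ^ 2

theorem sum_four_rotate {M : Type*} [AddCommMonoid M] (f : ι → ι → ι → ι → M) :
    ∑ x, ∑ y, ∑ z, ∑ w, f x z w y = ∑ x, ∑ y, ∑ z, ∑ w, f x y z w := by
  refine Finset.sum_congr rfl fun x _ => ?_
  rw [Finset.sum_comm]
  refine Finset.sum_congr rfl fun z _ => ?_
  rw [Finset.sum_comm]

theorem sum_four_swap {M : Type*} [AddCommMonoid M] (f : ι → ι → ι → ι → M) :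
    ∑ x, ∑ y, ∑ z, ∑ w, f z w x y = ∑ x, ∑ y, ∑ z, ∑ w, f x y z w := by
  have h : ∀ g : ι → ι → ι → ι → M,
      ∑ x, ∑ y, ∑ z, ∑ w, g x y z w = ∑ a : ι × ι, ∑ b : ι × ι, g a.1 a.2 b.1 b.2 := by
    intro g; simp only [Fintype.sum_prod_type]
  rw [h (fun x y z w => f z w x y), h f, Finset.sum_comm]

theorem sum_chi_sq [DecidableEq ι] (hp : GenPos p) :
    ∑ x, ∑ y, ∑ z, chi p x y z ^ 2 =
      (Fintype.card ι : ℤ) * (Fintype.card ι - 1) * (Fintype.card ι - 2) := by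
  have h : ∀ x y z, chi p x y z ^ 2 =
      (1 - if x = y then 1 else 0) * (1 - (if z = x then 1 else 0) - if z = y then 1 else 0) := by
    intro x y z
    by_cases hxy : x = y
    · subst hxy; simp [chi_self_left]
    by_cases hxz : z = x
    · subst hxz; simp [chi_self_outer, hxy]
    by_cases hyz : z = y
    · subst hyz; simp [chi_self_right, hxz]
    rcases hp.chi_eq hxy (Ne.symm hxz) (Ne.symm hyz) with e | e <;> simp [e, hxy, hxz, hyz]
  simp only [h, ← Finset.mul_sum, Finset.sum_sub_distrib, Finset.sum_ite_eq', Finset.sum_ite_eq,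
    Finset.mem_univ, if_true, ← Finset.sum_mul, Finset.sum_const, Finset.card_univ]
  simp
  ring

/-- The number of crossings of a point set is determined by how far the lines through two of its
points are from halving the set. -/
theorem crossCount_eq_energy [DecidableEq ι] (hp : GenPos p) :
    crossCount p = energy p -
      (Fintype.card ι : ℤ) * (Fintype.card ι - 1) * (Fintype.card ι - 2) := by
  set F : ι → ι → ι → ι → ℤ := fun x y z w =>
    if z = w then 0 else chi p x y z * chi p x y w with hF
  set G : ι → ι → ι → ι → ℤ := fun x y z w => if Cross p x y z w then 1 else 0 with hG
  have key : ∑ x, ∑ y, ∑ z, ∑ w, ((F x y z w + F z w x y) + (F x z w y + F w y x z)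
      + (F x w y z + F y z x w)) =
      ∑ x, ∑ y, ∑ z, ∑ w, 2 * (G x y z w + G x z w y + G x w y z) := by
    refine Finset.sum_congr rfl fun x _ => Finset.sum_congr rfl fun y _ =>
      Finset.sum_congr rfl fun z _ => Finset.sum_congr rfl fun w _ => ?_
    exact chi_four_point p hp x y z w
  simp only [Finset.sum_add_distrib, ← Finset.mul_sum] at key
  have r1 := sum_four_rotate F
  have r2 := sum_four_rotate (fun x y z w => F x z w y)
  have s1 := sum_four_swap F
  have s2 := sum_four_rotate (fun x y z w => F z w x y)
  have s3 := sum_four_rotate (fun x y z w => F w y x z)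
  have t1 := sum_four_rotate G
  have t2 := sum_four_rotate (fun x y z w => G x z w y)
  beta_reduce at r1 r2 s1 s2 s3 t1 t2
  have hc : crossCount p = ∑ x, ∑ y, ∑ z, ∑ w, G x y z w := rfl
  have he : energy p = ∑ x, ∑ y, ∑ z, ∑ w, F x y z w + ∑ x, ∑ y, ∑ z, chi p x y z ^ 2 := by
    unfold energy defect
    simp only [← Finset.sum_add_distrib]
    refine Finset.sum_congr rfl fun x _ => Finset.sum_congr rfl fun y _ => ?_
    rw [pow_two, Finset.sum_mul_sum]
    refine Finset.sum_congr rfl fun z _ => ?_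
    have : ∀ w, chi p x y z * chi p x y w = F x y z w + if z = w then chi p x y z ^ 2 else 0 := by
      intro w
      by_cases h : z = w
      · subst h; simp [hF, pow_two]
      · simp [hF, h]
    rw [Finset.sum_congr rfl fun w _ => this w, Finset.sum_add_distrib]
    simp
  rw [sum_chi_sq p hp] at he
  linarith

end counting

/-! ### Crossings of a drawing and crossing quadruples -/

theorem sgn_mul_eq_neg_one {a b : ℝ} : sgn a * sgn b = -1 ↔ a * b < 0 := by
  rw [← sgn_mul, sgn_eq_neg_one]

theorem orient_combo (a b c d : EuclideanSpace ℝ (Fin 2)) {s t : ℝ} (h : s + t = 1) :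
    orient a b (s • c + t • d) = s * orient a b c + t * orient a b d := by
  unfold orient
  simp only [PiLp.add_apply, PiLp.smul_apply, smul_eq_mul]
  obtain rfl : s = 1 - t := by linarith
  ring

theorem orient_combo_self (a b : EuclideanSpace ℝ (Fin 2)) {s t : ℝ} (h : s + t = 1) :
    orient a b (s • a + t • b) = 0 := by
  rw [orient_combo a b a b h]; unfold orient; ring

theorem openSegment_inter_nonempty_of_orient {a b c d : EuclideanSpace ℝ (Fin 2)}
    (h1 : orient a b c * orient a b d < 0) (h2 : orient c d a * orient c d b < 0) :
    (openSegment ℝ a b ∩ openSegment ℝ c d).Nonempty := by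
  have hab : ∀ u v : ℝ, u * v < 0 → 0 < u / (u - v) ∧ u / (u - v) < 1 ∧ u - v ≠ 0 := by
    intro u v huv
    rcases mul_neg_iff.1 huv with ⟨hu, hv⟩ | ⟨hu, hv⟩
    · have : 0 < u - v := by linarith
      exact ⟨by positivity, by rw [div_lt_one this]; linarith, this.ne'⟩
    · have : u - v < 0 := by linarith
      exact ⟨div_pos_of_neg_of_neg hu this, by rw [div_lt_one_of_neg this]; linarith, this.ne⟩
  obtain ⟨t0, t1, tne⟩ := hab _ _ h1
  obtain ⟨s0, s1, sne⟩ := hab _ _ h2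
  set t := orient a b c / (orient a b c - orient a b d) with ht
  set s := orient c d a / (orient c d a - orient c d b) with hs
  refine ⟨(1 - s) • a + s • b, ⟨1 - s, s, by linarith, s0, by ring, rfl⟩,
    ⟨1 - t, t, by linarith, t0, by ring, ?_⟩⟩
  have e : orient c d a - orient c d b = orient a b d - orient a b c + 0 := by
    unfold orient; ring
  have e' : s = -orient c d a / (orient a b c - orient a b d) := by
    rw [hs, e, div_eq_div_iff (by rw [← e]; exact sne) tne]; ring
  rw [e', ht]
  ext i
  simp only [PiLp.add_apply, PiLp.smul_apply, smul_eq_mul]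
  field_simp
  fin_cases i <;> (unfold orient; simp; ring)

theorem orient_mul_neg_of_mem {a b c d x : EuclideanSpace ℝ (Fin 2)}
    (hc : orient a b c ≠ 0) (h : orient a b x = 0) (hx : x ∈ openSegment ℝ c d) :
    orient a b c * orient a b d < 0 := by
  obtain ⟨s, t, hs, ht, hst, rfl⟩ := hx
  rw [orient_combo a b c d hst] at h
  have h2 : orient a b d = -(s / t) * orient a b c := by field_simp; linarith
  rw [h2]
  have h3 : 0 < orient a b c * orient a b c := mul_self_pos.2 hc
  have : 0 < s / t * (orient a b c * orient a b c) := by positivity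
  linarith

theorem orient_eq_zero_of_mem_segment {a b x : EuclideanSpace ℝ (Fin 2)}
    (hx : x ∈ segment ℝ a b) : orient a b x = 0 := by
  obtain ⟨s, t, hs, ht, hst, rfl⟩ := hx
  exact orient_combo_self a b hst

/-- Two non-parallel lines through a common point `a` meet only there. -/
theorem eq_of_orient_eq_zero {a b c x : EuclideanSpace ℝ (Fin 2)} (h : orient a b c ≠ 0)
    (hb : orient a b x = 0) (hc : orient a c x = 0) : x = a := by
  unfold orient at *
  have h0 : ((b 0 - a 0) * (c 1 - a 1) - (b 1 - a 1) * (c 0 - a 0)) * (x 0 - a 0) = 0 := by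
    linear_combination (c 0 - a 0) * hb - (b 0 - a 0) * hc
  have h1 : ((b 0 - a 0) * (c 1 - a 1) - (b 1 - a 1) * (c 0 - a 0)) * (x 1 - a 1) = 0 := by
    linear_combination (c 1 - a 1) * hb - (b 1 - a 1) * hc
  have g0 := (mul_eq_zero.1 h0).resolve_left h
  have g1 := (mul_eq_zero.1 h1).resolve_left h
  ext i
  fin_cases i
  · simpa using sub_eq_zero.1 g0
  · simpa using sub_eq_zero.1 g1

section crossings

variable {n : ℕ} {p : Fin n → EuclideanSpace ℝ (Fin 2)}

theorem Cross.nonempty {x y z w : Fin n} (h : Cross p x y z w) :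
    (edgeInterior p s(x, y) ∩ edgeInterior p s(z, w)).Nonempty :=
  openSegment_inter_nonempty_of_orient (sgn_mul_eq_neg_one.1 h.1) (sgn_mul_eq_neg_one.1 h.2)

theorem left_not_mem_openSegment {a b c : EuclideanSpace ℝ (Fin 2)} (h : orient a b c ≠ 0) :
    a ∉ openSegment ℝ a b := fun ha => by
  rw [left_mem_openSegment_iff] at ha
  apply h; rw [ha]; unfold orient; ring

theorem no_common_interior_of_common_vertex {a b c : EuclideanSpace ℝ (Fin 2)}
    (h : orient a b c ≠ 0) : ¬ (openSegment ℝ a b ∩ openSegment ℝ a c).Nonempty := by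
  rintro ⟨x, hb, hc⟩
  have := eq_of_orient_eq_zero h (orient_eq_zero_of_mem_segment (openSegment_subset_segment _ _ _ hb))
    (orient_eq_zero_of_mem_segment (openSegment_subset_segment _ _ _ hc))
  subst this
  exact left_not_mem_openSegment h hb

theorem cross_iff (hp : GenPos p) (x y z w : Fin n) : Cross p x y z w ↔
    x ≠ y ∧ z ≠ w ∧ s(x, y) ≠ s(z, w) ∧
      (edgeInterior p s(x, y) ∩ edgeInterior p s(z, w)).Nonempty := by
  constructor
  · intro h
    obtain ⟨hxy, hxz, hxw, hyz, hyw, hzw⟩ := h.distinct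
    refine ⟨hxy, hzw, ?_, h.nonempty⟩
    rw [Ne, Sym2.eq_iff]; tauto
  · rintro ⟨hxy, hzw, hne, hI⟩
    have hI' : (openSegment ℝ (p x) (p y) ∩ openSegment ℝ (p z) (p w)).Nonempty := hI
    rw [Ne, Sym2.eq_iff] at hne
    have hxz : x ≠ z := by
      rintro rfl
      exact no_common_interior_of_common_vertex (hp x y w hxy hzw (by tauto)) hI'
    have hxw : x ≠ w := by
      rintro rfl
      rw [openSegment_symm ℝ (p z)] at hI'
      exact no_common_interior_of_common_vertex (hp x y z hxy hxz (by tauto)) hI'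
    have hyz : y ≠ z := by
      rintro rfl
      rw [openSegment_symm ℝ (p x)] at hI'
      exact no_common_interior_of_common_vertex (hp y x w hxy.symm hzw hxw) hI'
    have hyw : y ≠ w := by
      rintro rfl
      rw [openSegment_symm ℝ (p x), openSegment_symm ℝ (p z)] at hI'
      exact no_common_interior_of_common_vertex (hp y x z hxy.symm hyz hxz) hI'
    obtain ⟨t, h1, h2⟩ := hI'
    constructor
    · exact sgn_mul_eq_neg_one.2 (orient_mul_neg_of_mem (hp x y z hxy hxz hyz)
        (orient_eq_zero_of_mem_segment (openSegment_subset_segment _ _ _ h1)) h2)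
    · exact sgn_mul_eq_neg_one.2 (orient_mul_neg_of_mem (hp z w x hzw hxz.symm hxw.symm)
        (orient_eq_zero_of_mem_segment (openSegment_subset_segment _ _ _ h2)) h1)

theorem sum_sym2_of_diag_eq_zero {V : Type*} [Fintype V] [DecidableEq V] (F : Sym2 V → ℤ)
    (hF : ∀ x, F s(x, x) = 0) : ∑ x, ∑ y, F s(x, y) = 2 * ∑ e, F e := by
  have h := Finset.sum_fiberwise_of_maps_to (s := (Finset.univ : Finset (V × V)))
    (t := (Finset.univ : Finset (Sym2 V))) (g := fun a => s(a.1, a.2)) (fun _ _ => Finset.mem_univ _)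
    (fun a => F s(a.1, a.2))
  rw [Fintype.sum_prod_type] at h
  rw [← h, Finset.mul_sum]
  refine Finset.sum_congr rfl fun e _ => ?_
  induction e with
  | h x y =>
    by_cases hxy : x = y
    · subst hxy
      rw [hF, mul_zero]
      refine Finset.sum_eq_zero fun a ha => ?_
      rw [(Finset.mem_filter.1 ha).2, hF]
    · have : (Finset.univ.filter fun a : V × V => s(a.1, a.2) = s(x, y)) = {(x, y), (y, x)} := by
        ext ⟨a, b⟩
        simp
      rw [this, Finset.sum_pair (by simp [hxy]), Sym2.eq_swap (a := y)]
      ring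

/-- Each crossing of a drawing is counted by eight ordered quadruples. -/
theorem eight_mul_crossings (hp : GenPos p) : (8 * crossings p : ℤ) = crossCount p := by
  classical
  let H : SimpleGraph (Sym2 (Fin n)) :=
    { Adj := fun e f => e ∈ (⊤ : SimpleGraph (Fin n)).edgeSet ∧
        f ∈ (⊤ : SimpleGraph (Fin n)).edgeSet ∧ e ≠ f ∧
        (edgeInterior p e ∩ edgeInterior p f).Nonempty
      symm := ⟨fun e f h => ⟨h.2.1, h.1, h.2.2.1.symm, by rw [Set.inter_comm]; exact h.2.2.2⟩⟩
      loopless := ⟨fun e h => h.2.2.1 rfl⟩ }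
  have hset : crossings p = H.edgeFinset.card := by
    rw [← Set.ncard_coe_finset, SimpleGraph.coe_edgeFinset]
    unfold crossings
    congr 1
    ext s
    induction s with
    | h e f =>
      simp only [Set.mem_ofPred_eq, SimpleGraph.mem_edgeSet, H]
      constructor
      · rintro ⟨e', he, f', hf, hne, hI, hs⟩
        rcases Sym2.eq_iff.1 hs with ⟨rfl, rfl⟩ | ⟨rfl, rfl⟩
        · exact ⟨he, hf, hne, hI⟩
        · exact ⟨hf, he, hne.symm, by rw [Set.inter_comm]; exact hI⟩
      · rintro ⟨he, hf, hne, hI⟩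
        exact ⟨e, he, f, hf, hne, hI, rfl⟩
  have hdeg : (2 * H.edgeFinset.card : ℤ) = ∑ e, ∑ f, if H.Adj e f then (1 : ℤ) else 0 := by
    have := H.sum_degrees_eq_twice_card_edges
    rw [← Nat.cast_two, ← Nat.cast_mul, ← this]
    push_cast
    refine Finset.sum_congr rfl fun e _ => ?_
    rw [Finset.sum_boole, ← SimpleGraph.card_neighborFinset_eq_degree,
      SimpleGraph.neighborFinset_eq_filter]
  have hsum : crossCount p = 2 * ∑ e, (2 * ∑ f, if H.Adj e f then (1 : ℤ) else 0) := by
    rw [← sum_sym2_of_diag_eq_zero (fun e => 2 * ∑ f, if H.Adj e f then (1 : ℤ) else 0)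
      (fun x => by simp [H])]
    unfold crossCount
    refine Finset.sum_congr rfl fun x _ => Finset.sum_congr rfl fun y _ => ?_
    rw [← sum_sym2_of_diag_eq_zero (fun f => if H.Adj s(x, y) f then (1 : ℤ) else 0)
      (fun z => by simp [H])]
    refine Finset.sum_congr rfl fun z _ => Finset.sum_congr rfl fun w _ => ?_
    refine if_congr ?_ rfl rfl
    rw [cross_iff hp]
    simp [H]
  rw [hsum, ← Finset.mul_sum, ← hdeg, hset]
  ring

end crossings

/-! ### Generic perturbations -/

section generic

/-- The determinant of the coefficient vectors of the lines `ab`, `cd` and `ef` through points with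
coordinate functions `x` and `y`. It vanishes if the three lines have a common point. -/
def lineDet {V R : Type*} [CommRing R] (x y : V → R) (a b c d e f : V) : R :=
  Matrix.det !![y a - y b, x b - x a, x a * y b - x b * y a;
    y c - y d, x d - x c, x c * y d - x d * y c;
    y e - y f, x f - x e, x e * y f - x f * y e]

theorem lineDet_eq_zero_of_orient {V : Type*} (p : V → EuclideanSpace ℝ (Fin 2))
    {a b c d e f : V} {t : EuclideanSpace ℝ (Fin 2)} (h1 : orient (p a) (p b) t = 0)
    (h2 : orient (p c) (p d) t = 0) (h3 : orient (p e) (p f) t = 0) :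
    lineDet (fun v => p v 0) (fun v => p v 1) a b c d e f = 0 := by
  unfold orient at h1 h2 h3
  simp only [lineDet, Matrix.det_fin_three, Matrix.of_apply, Matrix.cons_val', Matrix.cons_val_zero,
    Matrix.cons_val_one, Matrix.cons_val]
  linear_combination ((p c 1 - p d 1) * (p f 0 - p e 0) - (p e 1 - p f 1) * (p d 0 - p c 0)) * h1
    - ((p a 1 - p b 1) * (p f 0 - p e 0) - (p e 1 - p f 1) * (p b 0 - p a 0)) * h2
    + ((p a 1 - p b 1) * (p d 0 - p c 0) - (p c 1 - p d 1) * (p b 0 - p a 0)) * h3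

/-- Pairwise distinctness of six vertices. -/
def SixDistinct {V : Type*} (a b c d e f : V) : Prop := [a, b, c, d, e, f].Nodup

theorem not_mem_segment_of_orient_ne_zero {a b c : EuclideanSpace ℝ (Fin 2)}
    (h : orient a b c ≠ 0) : c ∉ segment ℝ a b := fun hc => h (orient_eq_zero_of_mem_segment hc)

theorem not_collinear_of_orient_ne_zero {a b c : EuclideanSpace ℝ (Fin 2)}
    (h : orient a b c ≠ 0) : ¬ Collinear ℝ {a, b, c} := by
  intro hc
  rw [collinear_iff_of_mem (p₀ := a) (by simp)] at hc
  obtain ⟨v, hv⟩ := hc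
  obtain ⟨r, hr⟩ := hv b (by simp)
  obtain ⟨s, hs⟩ := hv c (by simp)
  apply h
  unfold orient
  rw [hr, hs]
  simp
  ring

theorem GenPos.not_concurrent_of_common_vertex {n : ℕ} {q : Fin n → EuclideanSpace ℝ (Fin 2)}
    (hq : GenPos q) {a b c : Fin n} (hab : a ≠ b) (hac : a ≠ c) (hbc : b ≠ c) {g : Sym2 (Fin n)}
    (hg : g ∈ (⊤ : SimpleGraph (Fin n)).edgeSet) {x : EuclideanSpace ℝ (Fin 2)}
    (h1 : x ∈ edgeSegment q s(a, b)) (h2 : x ∈ edgeSegment q s(a, c)) (h3 : x ∈ edgeSegment q g) :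
    q a = x ∧ a ∈ g := by
  have hx : x = q a := eq_of_orient_eq_zero (hq a b c hab hac hbc)
    (orient_eq_zero_of_mem_segment h1) (orient_eq_zero_of_mem_segment h2)
  refine ⟨hx.symm, ?_⟩
  induction g with
  | h u v =>
    by_contra hn
    rw [Sym2.mem_iff, not_or] at hn
    have huv : u ≠ v := by simpa using hg
    exact not_mem_segment_of_orient_ne_zero (hq u v a huv (Ne.symm hn.1) (Ne.symm hn.2)) (hx ▸ h3)

theorem GenPos.not_concurrent_of_not_disjoint {n : ℕ} {q : Fin n → EuclideanSpace ℝ (Fin 2)}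
    (hq : GenPos q) {e f g : Sym2 (Fin n)} (he : e ∈ (⊤ : SimpleGraph (Fin n)).edgeSet)
    (hf : f ∈ (⊤ : SimpleGraph (Fin n)).edgeSet) (hg : g ∈ (⊤ : SimpleGraph (Fin n)).edgeSet)
    (hef : e ≠ f) {x : EuclideanSpace ℝ (Fin 2)} (h1 : x ∈ edgeSegment q e)
    (h2 : x ∈ edgeSegment q f) (h3 : x ∈ edgeSegment q g) {v : Fin n} (hve : v ∈ e) (hvf : v ∈ f) :
    q v = x ∧ v ∈ g := by
  obtain ⟨b, rfl⟩ := hve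
  obtain ⟨c, rfl⟩ := hvf
  have hab : v ≠ b := by simpa using he
  have hac : v ≠ c := by simpa using hf
  exact hq.not_concurrent_of_common_vertex hab hac (fun h => hef (by rw [h])) hg h1 h2 h3

theorem GenPos.isRectilinearDrawing {n : ℕ} {q : Fin n → EuclideanSpace ℝ (Fin 2)}
    (hq : GenPos q) (hinj : Function.Injective q)
    (hdet : ∀ a b c d e f, SixDistinct a b c d e f →
      lineDet (fun v => q v 0) (fun v => q v 1) a b c d e f ≠ 0) :
    IsRectilinearDrawing q where
  injective := hinj
  not_collinear i j k hij hik hjk := not_collinear_of_orient_ne_zero (hq i j k hij hik hjk)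
  not_concurrent := by
    intro e he f hf g hg hef heg hfg x h1 h2 h3
    by_cases A : ∃ v, v ∈ e ∧ v ∈ f
    · obtain ⟨v, hve, hvf⟩ := A
      obtain ⟨hx, hvg⟩ := hq.not_concurrent_of_not_disjoint he hf hg hef h1 h2 h3 hve hvf
      exact ⟨⟨v, hve, hx⟩, ⟨v, hvf, hx⟩, ⟨v, hvg, hx⟩⟩
    by_cases B : ∃ v, v ∈ e ∧ v ∈ g
    · obtain ⟨v, hve, hvg⟩ := B
      obtain ⟨hx, hvf⟩ := hq.not_concurrent_of_not_disjoint he hg hf heg h1 h3 h2 hve hvg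
      exact ⟨⟨v, hve, hx⟩, ⟨v, hvf, hx⟩, ⟨v, hvg, hx⟩⟩
    by_cases C : ∃ v, v ∈ f ∧ v ∈ g
    · obtain ⟨v, hvf, hvg⟩ := C
      obtain ⟨hx, hve⟩ := hq.not_concurrent_of_not_disjoint hf hg he hfg h2 h3 h1 hvf hvg
      exact ⟨⟨v, hve, hx⟩, ⟨v, hvf, hx⟩, ⟨v, hvg, hx⟩⟩
    exfalso
    induction e with
    | h a b =>
    induction f with
    | h c d =>
    induction g with
    | h u w =>
      refine hdet a b c d u w ?_ (lineDet_eq_zero_of_orient q (orient_eq_zero_of_mem_segment h1)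
        (orient_eq_zero_of_mem_segment h2) (orient_eq_zero_of_mem_segment h3))
      have hab : a ≠ b := by simpa using he
      have hcd : c ≠ d := by simpa using hf
      have huw : u ≠ w := by simpa using hg
      simp only [Sym2.mem_iff] at A B C
      push Not at A B C
      have A1 := A a (.inl rfl)
      have A2 := A b (.inr rfl)
      have B1 := B a (.inl rfl)
      have B2 := B b (.inr rfl)
      have C1 := C c (.inl rfl)
      have C2 := C d (.inr rfl)
      simp [SixDistinct, hab, hcd, huw, A1, A2, B1, B2, C1, C2]

theorem sgn_eq_of_mul_pos {a b : ℝ} (h : 0 < a * b) : sgn a = sgn b := by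
  rcases mul_pos_iff.1 h with ⟨h1, h2⟩ | ⟨h1, h2⟩
  · rw [sgn_pos h1, sgn_pos h2]
  · rw [sgn_neg h1, sgn_neg h2]

/-- The placement of points with the given coordinates. -/
noncomputable def ofCoords {V : Type*} (c : V × Fin 2 → ℝ) (v : V) : EuclideanSpace ℝ (Fin 2) :=
  !₂[c (v, 0), c (v, 1)]

theorem lineDet_X_ne_zero {V : Type*} {a b c d e f : V} (h : SixDistinct a b c d e f) :
    lineDet (fun v => (MvPolynomial.X (v, 0) : MvPolynomial (V × Fin 2) ℝ))
      (fun v => MvPolynomial.X (v, 1)) a b c d e f ≠ 0 := by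
  classical
  intro h0
  -- The lines `ab`, `cd`, `ef` become the two axes and the line `x + y = 1`.
  have h1 := congrArg (MvPolynomial.eval (fun v : V × Fin 2 =>
    if (v.2 = 0 ∧ (v.1 = d ∨ v.1 = e)) ∨ (v.2 = 1 ∧ (v.1 = b ∨ v.1 = f)) then (1 : ℝ) else 0)) h0
  simp only [SixDistinct, List.nodup_cons, List.mem_cons, List.not_mem_nil, or_false, not_or,
    not_false_eq_true, List.nodup_nil, and_true] at h
  obtain ⟨⟨h1', h2, h3, h4, h5⟩, ⟨h6, h7, h8, h9⟩, ⟨h10, h11, h12⟩, ⟨h13, h14⟩, h15⟩ := h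
  simp [lineDet, Matrix.det_fin_three, *, Ne.symm, eq_comm] at h1

/-- Every point set without collinear triples can be perturbed, keeping all orientations, to a
rectilinear drawing in which no two vertices are on a vertical line: the excluded coordinates are
zeros of finitely many nonzero polynomials. -/
theorem GenPos.exists_drawing {n : ℕ} {p : Fin n → EuclideanSpace ℝ (Fin 2)} (hp : GenPos p) :
    ∃ q : Fin n → EuclideanSpace ℝ (Fin 2), (∀ i j k, chi q i j k = chi p i j k) ∧
      IsRectilinearDrawing q ∧ ∀ i j, i ≠ j → q i 0 ≠ q j 0 := by
  classical
  let c₀ : Fin n × Fin 2 → ℝ := fun v => p v.1 v.2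
  let U : Set (Fin n × Fin 2 → ℝ) := {c | ∀ t : {t : Fin n × Fin n × Fin n //
    t.1 ≠ t.2.1 ∧ t.1 ≠ t.2.2 ∧ t.2.1 ≠ t.2.2},
    0 < orient (ofCoords c t.1.1) (ofCoords c t.1.2.1) (ofCoords c t.1.2.2) *
      orient (p t.1.1) (p t.1.2.1) (p t.1.2.2)}
  have hU : IsOpen U := by
    simp only [U, Set.ofPred_forall]
    refine isOpen_iInter_of_finite fun t => ?_
    refine isOpen_lt continuous_const ?_
    simp only [orient, ofCoords]
    simp
    fun_prop
  have hc₀ : c₀ ∈ U := by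
    rintro ⟨⟨i, j, k⟩, h1, h2, h3⟩
    have : ∀ v, ofCoords c₀ v = p v := by
      intro v; ext i; fin_cases i <;> simp [ofCoords, c₀]
    simp only [this]
    exact mul_self_pos.2 (hp i j k h1 h2 h3)
  obtain ⟨ε, hε, hball⟩ := Metric.isOpen_iff.1 hU c₀ hc₀
  let Φ : MvPolynomial (Fin n × Fin 2) ℝ :=
    (∏ t : {t : Fin n × Fin n // t.1 ≠ t.2},
      (MvPolynomial.X (t.1.1, 0) - MvPolynomial.X (t.1.2, 0))) *
    ∏ t : {t : Fin n × Fin n × Fin n × Fin n × Fin n × Fin n //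
        SixDistinct t.1 t.2.1 t.2.2.1 t.2.2.2.1 t.2.2.2.2.1 t.2.2.2.2.2},
      lineDet (fun v => (MvPolynomial.X (v, 0) : MvPolynomial (Fin n × Fin 2) ℝ))
        (fun v => MvPolynomial.X (v, 1)) t.1.1 t.1.2.1 t.1.2.2.1 t.1.2.2.2.1 t.1.2.2.2.2.1
          t.1.2.2.2.2.2
  have hΦ : Φ ≠ 0 := by
    refine mul_ne_zero (Finset.prod_ne_zero_iff.2 ?_) (Finset.prod_ne_zero_iff.2 ?_)
    · rintro ⟨⟨i, j⟩, hij⟩ - h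
      have := MvPolynomial.X_injective (R := ℝ) (sub_eq_zero.1 h)
      exact hij (by simpa using this)
    · rintro ⟨⟨a, b, c, d, e, f⟩, h⟩ -
      exact lineDet_X_ne_zero h
  obtain ⟨c, hcb, hc⟩ : ∃ c ∈ Metric.ball c₀ ε, MvPolynomial.eval c Φ ≠ 0 := by
    by_contra hcon
    push Not at hcon
    apply hΦ
    refine MvPolynomial.funext_set (fun i => Metric.ball (c₀ i) ε) (fun i => ?_) fun c hc => ?_
    · rw [Real.ball_eq_Ioo]
      exact Set.Ioo_infinite (by linarith)
    · rw [← ball_pi _ hε] at hc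
      rw [hcon c hc, map_zero]
  have hcU := hball hcb
  have hchi : ∀ i j k, chi (ofCoords c) i j k = chi p i j k := by
    intro i j k
    by_cases hij : i = j
    · subst hij; rw [chi_self_left, chi_self_left]
    by_cases hik : i = k
    · subst hik; rw [chi_self_outer, chi_self_outer]
    by_cases hjk : j = k
    · subst hjk; rw [chi_self_right, chi_self_right]
    exact sgn_eq_of_mul_pos (hcU ⟨(i, j, k), hij, hik, hjk⟩)
  rw [map_mul, map_prod, map_prod, mul_ne_zero_iff, Finset.prod_ne_zero_iff,
    Finset.prod_ne_zero_iff] at hc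
  have hx : ∀ i j, i ≠ j → ofCoords c i 0 ≠ ofCoords c j 0 := by
    intro i j hij h
    apply hc.1 ⟨(i, j), hij⟩ (Finset.mem_univ _)
    simp [ofCoords] at h
    simp [h]
  refine ⟨ofCoords c, hchi, (hp.of_chi_eq hchi).isRectilinearDrawing ?_ ?_, hx⟩
  · intro i j hij
    by_contra h
    exact hx i j h (by rw [hij])
  · intro a b d e f g h h0
    apply hc.2 ⟨(a, b, d, e, f, g), h⟩ (Finset.mem_univ _)
    rw [← h0]
    simp [lineDet, Matrix.det_fin_three, ofCoords]

end generic

/-! ### Replacing every point by a flat copy of another point set -/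

section ranks

variable {α : Type*} [Fintype α] (x : α → ℝ)

/-- The number of indices with a smaller value of `x` minus the number of those with a larger
one. -/
noncomputable def rankDiff (a : α) : ℤ := ∑ e, sgn (x a - x e)

theorem sum_rankDiff : ∑ a, rankDiff x a = 0 := by
  have h : ∑ a, rankDiff x a = -∑ a, rankDiff x a := by
    conv_rhs => unfold rankDiff
    rw [Finset.sum_comm, ← Finset.sum_neg_distrib]
    refine Finset.sum_congr rfl fun a _ => ?_
    rw [← Finset.sum_neg_distrib]
    unfold rankDiff
    refine Finset.sum_congr rfl fun e _ => ?_
    rw [← sgn_neg_eq, neg_sub]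
  omega

theorem three_mul_sum_rankDiff_sq_le :
    3 * ∑ a, rankDiff x a ^ 2 ≤ (Fintype.card α : ℤ) ^ 3 := by
  have hsq : ∑ a, rankDiff x a ^ 2 = ∑ a, ∑ b, ∑ c, sgn (x a - x b) * sgn (x a - x c) := by
    refine Finset.sum_congr rfl fun a _ => ?_
    rw [pow_two, rankDiff, Finset.sum_mul_sum]
  have hrot : ∀ g : α → α → α → ℤ, ∑ a, ∑ b, ∑ c, g b c a = ∑ a, ∑ b, ∑ c, g a b c := by
    intro g
    rw [Finset.sum_comm]
    exact Finset.sum_congr rfl fun a _ => Finset.sum_comm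
  have h1 := hrot fun a b c => sgn (x a - x b) * sgn (x a - x c)
  have h2 := hrot fun a b c => sgn (x b - x c) * sgn (x b - x a)
  beta_reduce at h1 h2
  -- Only the least and the greatest of three distinct values have equal signs.
  have hle : ∑ a, ∑ b, ∑ c, (sgn (x a - x b) * sgn (x a - x c)
      + sgn (x b - x c) * sgn (x b - x a) + sgn (x c - x a) * sgn (x c - x b)) ≤
      ∑ _a : α, ∑ _b : α, ∑ _c : α, (1 : ℤ) := by
    refine Finset.sum_le_sum fun a _ => Finset.sum_le_sum fun b _ => Finset.sum_le_sum fun c _ => ?_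
    rw [← neg_sub (x a) (x b), ← neg_sub (x a) (x c), ← neg_sub (x b) (x c), sgn_neg_eq, sgn_neg_eq,
      sgn_neg_eq]
    rcases sgn_cases (x a - x b) with ⟨h, e⟩ | ⟨h, e⟩ | ⟨h, e⟩ <;>
    rcases sgn_cases (x a - x c) with ⟨h', e'⟩ | ⟨h', e'⟩ | ⟨h', e'⟩ <;>
    rcases sgn_cases (x b - x c) with ⟨h'', e''⟩ | ⟨h'', e''⟩ | ⟨h'', e''⟩ <;>
    rw [e, e', e''] <;> norm_num
  simp only [Finset.sum_add_distrib, Finset.sum_const, Finset.card_univ] at hle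
  simp only [nsmul_eq_mul, mul_one] at hle
  rw [hsq]
  calc _ ≤ _ := le_of_eq (by linarith)
    _ ≤ _ := hle
    _ = _ := by ring

/-- The mean square of the defect of the lines between two clusters, abstractly: all cross terms
cancel. -/
theorem sum_sq_cross_terms (r T T' : α → ℤ) (d : ℤ) (hr : ∑ a, r a = 0) (hT : ∀ a, T a ^ 2 = 1)
    (hT' : ∀ a, T' a ^ 2 = 1) (h : (∑ a, r a * T' a) * ∑ c, r c * T c = 0) :
    ∑ a, ∑ c, (Fintype.card α * d + r a * T c - r c * T' a) ^ 2 =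
      (Fintype.card α : ℤ) ^ 4 * d ^ 2 + 2 * Fintype.card α * ∑ a, r a ^ 2 := by
  set m : ℤ := (Fintype.card α : ℤ) with hm
  have e : ∀ a c, (m * d + r a * T c - r c * T' a) ^ 2 =
      m ^ 2 * d ^ 2 + r a ^ 2 + r c ^ 2 + (2 * m * d) * (r a * T c) - (2 * m * d) * (T' a * r c)
        - 2 * ((r a * T' a) * (r c * T c)) := by
    intro a c
    linear_combination r a ^ 2 * hT c + r c ^ 2 * hT' a
  simp only [e, Finset.sum_add_distrib, Finset.sum_sub_distrib, ← Finset.mul_sum,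
    ← Finset.sum_mul, h, hr, Finset.sum_const, Finset.card_univ, nsmul_eq_mul, ← hm]
  ring

end ranks

section energyBound

variable {κ α : Type*} (b : κ → EuclideanSpace ℝ (Fin 2)) (f : κ → κ) [DecidableEq κ]
  (D : α → EuclideanSpace ℝ (Fin 2))

/-- The side of a line through two points of the cluster at `b i` on which the point `c` of the
cluster at `b j` lies. If the lines of cluster `i` point towards cluster `j = f i`, they split it
according to the first coordinate of `D`. -/
noncomputable def clusterSide (i j : κ) (c : α) : ℤ :=
  if j = f i then sgn (D c 0) * chi b i j (f j) else chi b i (f i) j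

/-- `P` is a placement in which each point `b i` is replaced by a copy of `D` flattened along the
line from `b i` to `b (f i)`, as far as orientations are concerned. -/
structure IsBlowUp (P : κ × α → EuclideanSpace ℝ (Fin 2)) : Prop where
  base : ∀ i j k a c e, i ≠ j → i ≠ k → j ≠ k → chi P (i, a) (j, c) (k, e) = chi b i j k
  pair : ∀ i j a a' c, i ≠ j →
    chi P (i, a) (i, a') (j, c) = sgn (D a' 0 - D a 0) * clusterSide b f D i j c
  cluster : ∀ i a a' a'', chi P (i, a) (i, a') (i, a'') = chi D a a' a''

variable {b f D}

theorem clusterSide_sq (hb : GenPos b) (hf : ∀ i, f i ≠ i) (hff : ∀ i, f (f i) ≠ i)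
    (hD : ∀ c, D c 0 ≠ 0) {i j : κ} (hij : i ≠ j) (c : α) : clusterSide b f D i j c ^ 2 = 1 := by
  unfold clusterSide
  split_ifs with h
  · subst h
    have h2 := sgn_sq (hD c)
    rcases hb.chi_eq hij (hff i).symm (hf (f i)).symm with e | e <;> rw [e] <;> linarith
  · rcases hb.chi_eq (hf i).symm hij (Ne.symm h) with e | e <;> rw [e] <;> norm_num

theorem IsBlowUp.genPos (hb : GenPos b) (hf : ∀ i, f i ≠ i) (hff : ∀ i, f (f i) ≠ i)
    (hD : ∀ c, D c 0 ≠ 0) (hx : ∀ a c, a ≠ c → D a 0 ≠ D c 0) (hDg : GenPos D)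
    {P : κ × α → EuclideanSpace ℝ (Fin 2)} (hP : IsBlowUp b f D P) : GenPos P := by
  have hpair : ∀ i j a a' c, i ≠ j → a ≠ a' → chi P (i, a) (i, a') (j, c) ≠ 0 := by
    intro i j a a' c hij ha
    rw [hP.pair i j a a' c hij]
    refine mul_ne_zero (fun h => hx a' a ha.symm (sub_eq_zero.1 (sgn_eq_zero.1 h))) fun h => ?_
    have := clusterSide_sq hb hf hff hD hij c
    rw [h] at this
    norm_num at this
  suffices h : ∀ u v w, u ≠ v → u ≠ w → v ≠ w → chi P u v w ≠ 0 from
    fun u v w h1 h2 h3 h0 => h u v w h1 h2 h3 (sgn_eq_zero.2 h0)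
  rintro ⟨i, a⟩ ⟨j, c⟩ ⟨k, e⟩ h1 h2 h3
  by_cases hij : i = j
  · subst hij
    have hac : a ≠ c := fun h => h1 (by rw [h])
    by_cases hik : i = k
    · subst hik
      rw [hP.cluster]
      exact hDg.chi_ne_zero hac (fun h => h2 (by rw [h])) (fun h => h3 (by rw [h]))
    · exact hpair _ _ _ _ _ hik hac
  · by_cases hik : i = k
    · subst hik
      rw [chi_rotate P (i, e) (i, a) (j, c)]
      exact hpair _ _ _ _ _ hij (fun h => h2 (by rw [h]))
    · by_cases hjk : j = k
      · subst hjk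
        rw [← chi_rotate]
        exact hpair _ _ _ _ _ (Ne.symm hij) (fun h => h3 (by rw [h]))
      · rw [hP.base _ _ _ _ _ _ hij hik hjk]
        exact hb.chi_ne_zero hij hik hjk

variable [Fintype α]

theorem sum_clusterSide (hD0 : ∑ c, sgn (D c 0) = 0) (i j : κ) :
    ∑ c, clusterSide b f D i j c = Fintype.card α * chi b i (f i) j := by
  unfold clusterSide
  split_ifs with h
  · subst h
    rw [← Finset.sum_mul, hD0, chi_self_right]; ring
  · simp

/-- If `f` has no 2-cycle, one of the two clusters `i`, `j` lies on one side of the lines of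
the other. -/
theorem sum_rankDiff_mul_clusterSide (hff : ∀ i, f (f i) ≠ i) (i j : κ) :
    (∑ a, rankDiff (fun e => D e 0) a * clusterSide b f D j i a) *
      ∑ c, rankDiff (fun e => D e 0) c * clusterSide b f D i j c = 0 := by
  have h : ∀ i j, j ≠ f i →
      ∑ c, rankDiff (fun e => D e 0) c * clusterSide b f D i j c = 0 := by
    intro i j hij
    unfold clusterSide
    simp only [if_neg hij, ← Finset.sum_mul, sum_rankDiff, zero_mul]
  by_cases hij : j = f i
  · rw [h j i (by rw [hij]; exact (hff i).symm), zero_mul]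
  · rw [h i j hij, mul_zero]

variable [Fintype κ]

theorem IsBlowUp.defect_of_ne {P : κ × α → EuclideanSpace ℝ (Fin 2)} (hP : IsBlowUp b f D P)
    {i j : κ} (hij : i ≠ j) (a c : α) :
    defect P (i, a) (j, c) = Fintype.card α * defect b i j
      + rankDiff (fun e => D e 0) a * clusterSide b f D i j c
      - rankDiff (fun e => D e 0) c * clusterSide b f D j i a := by
  have h : ∀ k, ∑ e, chi P (i, a) (j, c) (k, e) = Fintype.card α * chi b i j k
      + (if k = i then rankDiff (fun e => D e 0) a * clusterSide b f D i j c else 0)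
      + (if k = j then -(rankDiff (fun e => D e 0) c * clusterSide b f D j i a) else 0) := by
    intro k
    by_cases hki : k = i
    · subst hki
      rw [chi_self_outer, if_pos rfl, if_neg hij, rankDiff, Finset.sum_mul]
      simp only [mul_zero, zero_add, add_zero]
      refine Finset.sum_congr rfl fun e _ => ?_
      rw [chi_rotate P (k, e) (k, a) (j, c), hP.pair _ _ _ _ _ hij]
    · by_cases hkj : k = j
      · subst hkj
        rw [chi_self_right, if_pos rfl, if_neg hki, rankDiff, Finset.sum_mul,
          ← Finset.sum_neg_distrib]
        simp only [mul_zero, zero_add]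
        refine Finset.sum_congr rfl fun e _ => ?_
        rw [← chi_rotate, hP.pair _ _ _ _ _ hij.symm, ← neg_mul, ← sgn_neg_eq, neg_sub]
      · rw [if_neg hki, if_neg hkj, Finset.sum_congr rfl fun e _ =>
          hP.base i j k a c e hij (Ne.symm hki) (Ne.symm hkj)]
        simp
  unfold defect
  rw [Fintype.sum_prod_type, Finset.sum_congr rfl fun k _ => h k]
  simp only [Finset.sum_add_distrib, Finset.sum_ite_eq', Finset.mem_univ, if_true, ← Finset.mul_sum]
  ring

/-- Lines through two points of one cluster halve the rest of the blow-up, so only the cluster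
itself contributes to their defect. -/
theorem IsBlowUp.defect_same (hD0 : ∑ c, sgn (D c 0) = 0) (hb0 : ∀ i, defect b i (f i) = 0)
    {P : κ × α → EuclideanSpace ℝ (Fin 2)} (hP : IsBlowUp b f D P) (i : κ) (a c : α) :
    defect P (i, a) (i, c) = defect D a c := by
  have h : ∀ k, ∑ e, chi P (i, a) (i, c) (k, e) = (if k = i then defect D a c else 0)
      + sgn (D c 0 - D a 0) * Fintype.card α * chi b i (f i) k := by
    intro k
    by_cases hki : k = i
    · subst hki
      rw [if_pos rfl, chi_self_outer, defect]
      simp [hP.cluster]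
    · rw [if_neg hki, Finset.sum_congr rfl fun e _ => hP.pair i k a c e (Ne.symm hki),
        ← Finset.mul_sum, sum_clusterSide hD0]
      ring
  have hb1 := hb0 i
  unfold defect at hb1 ⊢
  rw [Fintype.sum_prod_type, Finset.sum_congr rfl fun k _ => h k]
  simp only [Finset.sum_add_distrib, Finset.sum_ite_eq', Finset.mem_univ, if_true, ← Finset.mul_sum,
    hb1, defect]
  ring

theorem IsBlowUp.energy_le (hb : GenPos b) (hf : ∀ i, f i ≠ i) (hff : ∀ i, f (f i) ≠ i)
    (hD : ∀ c, D c 0 ≠ 0) (hD0 : ∑ c, sgn (D c 0) = 0) (hb0 : ∀ i, defect b i (f i) = 0)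
    {P : κ × α → EuclideanSpace ℝ (Fin 2)} (hP : IsBlowUp b f D P) :
    3 * energy P ≤ Fintype.card κ * (3 * energy D) + (Fintype.card α : ℤ) ^ 4 *
      (3 * energy b + 2 * Fintype.card κ * (Fintype.card κ - 1)) := by
  set m : ℤ := (Fintype.card α : ℤ) with hm
  have hr := three_mul_sum_rankDiff_sq_le (fun e => D e 0)
  have h : ∀ i j, 3 * ∑ a, ∑ c, defect P (i, a) (j, c) ^ 2 ≤
      (if i = j then 3 * energy D - 2 * m ^ 4 else 0)
        + 3 * m ^ 4 * defect b i j ^ 2 + 2 * m ^ 4 := by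
    intro i j
    by_cases hij : i = j
    · subst hij
      have : defect b i i = 0 := by simp [defect, chi_self_left]
      rw [if_pos rfl, this, Finset.sum_congr rfl fun a _ => Finset.sum_congr rfl fun c _ =>
        congrArg (· ^ 2) (hP.defect_same hD0 hb0 i a c)]
      unfold energy
      linarith
    · rw [if_neg hij, Finset.sum_congr rfl fun a _ => Finset.sum_congr rfl fun c _ =>
        congrArg (· ^ 2) (hP.defect_of_ne hij a c), sum_sq_cross_terms _ _ _ _ (sum_rankDiff _)
        (clusterSide_sq hb hf hff hD hij) (clusterSide_sq hb hf hff hD (Ne.symm hij))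
        (sum_rankDiff_mul_clusterSide hff i j), ← hm]
      have hm0 : 0 ≤ m := by positivity
      have := mul_le_mul_of_nonneg_left hr hm0
      rw [← hm] at this
      linarith
  have hE : energy P = ∑ i, ∑ j, ∑ a, ∑ c, defect P (i, a) (j, c) ^ 2 := by
    unfold energy
    rw [Fintype.sum_prod_type]
    refine Finset.sum_congr rfl fun i _ => ?_
    simp only [Fintype.sum_prod_type]
    rw [Finset.sum_comm]
  rw [hE, Finset.mul_sum]
  simp only [Finset.mul_sum]
  calc _ ≤ _ := Finset.sum_le_sum fun i _ => Finset.sum_le_sum fun j _ => by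
        simpa only [Finset.mul_sum] using h i j
    _ = _ := by
        simp only [Finset.sum_add_distrib, ← Finset.mul_sum, Finset.sum_ite_eq, Finset.mem_univ,
          if_true, Finset.sum_const, Finset.card_univ, nsmul_eq_mul]
        unfold energy
        ring

end energyBound

theorem sq_add_sq_pos_of_ne {a b : EuclideanSpace ℝ (Fin 2)} (h : a ≠ b) :
    0 < (b 0 - a 0) ^ 2 + (b 1 - a 1) ^ 2 := by
  by_contra hn
  apply h
  have h0 : b 0 - a 0 = 0 := by nlinarith [sq_nonneg (b 0 - a 0), sq_nonneg (b 1 - a 1)]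
  have h1 : b 1 - a 1 = 0 := by nlinarith [sq_nonneg (b 0 - a 0), sq_nonneg (b 1 - a 1)]
  ext t
  fin_cases t
  · exact (sub_eq_zero.1 h0).symm
  · exact (sub_eq_zero.1 h1).symm

section construction

variable {κ α : Type*} (b : κ → EuclideanSpace ℝ (Fin 2)) (f : κ → κ)
  (D : α → EuclideanSpace ℝ (Fin 2))

/-- The blow-up with parameter `ε`: around `b i`, the first coordinate of `D` is scaled by `ε` and
laid along `b (f i) - b i`, the second coordinate is scaled by `ε ^ 3` and laid along the
perpendicular direction. The exponent `3` makes the cluster so flat that the line through two of its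
points still passes between the points of the cluster at `b (f i)`, which has size `ε`. -/
noncomputable def blowUp (ε : ℝ) (u : κ × α) : EuclideanSpace ℝ (Fin 2) :=
  !₂[b u.1 0 + ε * D u.2 0 * (b (f u.1) 0 - b u.1 0) - ε ^ 3 * D u.2 1 * (b (f u.1) 1 - b u.1 1),
    b u.1 1 + ε * D u.2 0 * (b (f u.1) 1 - b u.1 1) + ε ^ 3 * D u.2 1 * (b (f u.1) 0 - b u.1 0)]

theorem eventually_sgn_eq {g h : ℝ → ℝ} {n : ℕ} (hg : ∀ ε, g ε = ε ^ n * h ε) (hh : Continuous h)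
    (h0 : h 0 ≠ 0) : ∀ᶠ ε in 𝓝[>] (0 : ℝ), sgn (g ε) = sgn (h 0) := by
  have h1 : ∀ᶠ ε in 𝓝[>] (0 : ℝ), 0 < h ε * h 0 := by
    have : Tendsto (fun ε => h ε * h 0) (𝓝[>] 0) (𝓝 (h 0 * h 0)) :=
      ((hh.tendsto 0).mul_const _).mono_left nhdsWithin_le_nhds
    exact this.eventually_const_lt (mul_self_pos.2 h0)
  filter_upwards [h1, self_mem_nhdsWithin] with ε hε hpos
  have hpos' : 0 < ε := hpos
  rw [hg, sgn_mul, sgn_pos (pow_pos hpos' n), one_mul, sgn_eq_of_mul_pos hε]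

variable {b f D}

theorem eventually_chi_blowUp_base (hb : GenPos b) {i j k : κ} (hij : i ≠ j) (hik : i ≠ k)
    (hjk : j ≠ k) (a c e : α) :
    ∀ᶠ ε in 𝓝[>] (0 : ℝ), chi (blowUp b f D ε) (i, a) (j, c) (k, e) = chi b i j k := by
  have h0 : orient (blowUp b f D 0 (i, a)) (blowUp b f D 0 (j, c)) (blowUp b f D 0 (k, e)) =
      orient (b i) (b j) (b k) := by
    simp [blowUp, orient]
  have := eventually_sgn_eq (n := 0) (g := fun ε => orient (blowUp b f D ε (i, a))
    (blowUp b f D ε (j, c)) (blowUp b f D ε (k, e))) (fun ε => by rw [pow_zero, one_mul])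
    (by simp only [blowUp, orient]; simp; fun_prop) (by rw [h0]; exact hb i j k hij hik hjk)
  beta_reduce at this
  rw [h0] at this
  exact this

theorem eventually_chi_blowUp_pair [DecidableEq κ] (hb : GenPos b) (hf : ∀ i, f i ≠ i)
    (hff : ∀ i, f (f i) ≠ i) (hD : ∀ c, D c 0 ≠ 0) (hx : ∀ a c, a ≠ c → D a 0 ≠ D c 0) {i j : κ}
    (hij : i ≠ j) (a a' c : α) :
    ∀ᶠ ε in 𝓝[>] (0 : ℝ), chi (blowUp b f D ε) (i, a) (i, a') (j, c) =
      sgn (D a' 0 - D a 0) * clusterSide b f D i j c := by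
  by_cases ha : a = a'
  · subst ha
    simp [chi_self_left, sgn_zero]
  have hdx : D a' 0 - D a 0 ≠ 0 := sub_ne_zero.2 (hx a' a (Ne.symm ha))
  unfold clusterSide
  split_ifs with h
  · subst h
    -- The term of order `ε` vanishes because `b (f i)` lies on the axis of cluster `i`, so the
    -- orientation is `ε ^ 2 * h ε`.
    let h : ℝ → ℝ := fun ε =>
      (D a' 0 - D a 0) * ((b (f i) 0 - b i 0) *
        (D c 0 * (b (f (f i)) 1 - b (f i) 1) - D a 0 * (b (f i) 1 - b i 1)
          + ε ^ 2 * (D c 1 * (b (f (f i)) 0 - b (f i) 0) - D a 1 * (b (f i) 0 - b i 0)))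
        - (b (f i) 1 - b i 1) *
        (D c 0 * (b (f (f i)) 0 - b (f i) 0) - D a 0 * (b (f i) 0 - b i 0)
          - ε ^ 2 * (D c 1 * (b (f (f i)) 1 - b (f i) 1) - D a 1 * (b (f i) 1 - b i 1))))
      + ε * (D a' 1 - D a 1) * (-(b (f i) 1 - b i 1) *
          (blowUp b f D ε (f i, c) 1 - blowUp b f D ε (i, a) 1)
        - (b (f i) 0 - b i 0) * (blowUp b f D ε (f i, c) 0 - blowUp b f D ε (i, a) 0))
    have h0 : h 0 = (D a' 0 - D a 0) * (D c 0 * orient (b i) (b (f i)) (b (f (f i)))) := by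
      simp only [h, orient]; ring
    have := eventually_sgn_eq (n := 2) (h := h) (g := fun ε => orient (blowUp b f D ε (i, a))
      (blowUp b f D ε (i, a')) (blowUp b f D ε (f i, c)))
      (fun ε => by simp only [h, blowUp, orient]; simp; ring)
      (by simp only [h, blowUp]; simp; fun_prop)
      (by rw [h0]; exact mul_ne_zero hdx (mul_ne_zero (hD c)
        (hb _ _ _ (hf i).symm (hff i).symm (hf (f i)).symm)))
    rw [h0, sgn_mul, sgn_mul] at this
    exact this
  · let h' : ℝ → ℝ := fun ε =>
      ((D a' 0 - D a 0) * (b (f i) 0 - b i 0) - ε ^ 2 * (D a' 1 - D a 1) * (b (f i) 1 - b i 1)) *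
        (blowUp b f D ε (j, c) 1 - blowUp b f D ε (i, a) 1)
      - ((D a' 0 - D a 0) * (b (f i) 1 - b i 1) + ε ^ 2 * (D a' 1 - D a 1) * (b (f i) 0 - b i 0)) *
        (blowUp b f D ε (j, c) 0 - blowUp b f D ε (i, a) 0)
    have h0 : h' 0 = (D a' 0 - D a 0) * orient (b i) (b (f i)) (b j) := by
      simp only [h', blowUp, orient]; simp; ring
    have := eventually_sgn_eq (n := 1) (h := h') (g := fun ε => orient (blowUp b f D ε (i, a))
      (blowUp b f D ε (i, a')) (blowUp b f D ε (j, c)))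
      (fun ε => by simp only [h', blowUp, orient]; simp; ring)
      (by simp only [h', blowUp]; simp; fun_prop)
      (by rw [h0]; exact mul_ne_zero hdx (hb _ _ _ (hf i).symm hij (Ne.symm h)))
    rw [h0, sgn_mul] at this
    exact this

theorem chi_blowUp_cluster {i : κ} (hi : b (f i) ≠ b i) {ε : ℝ} (hε : 0 < ε) (a a' a'' : α) :
    chi (blowUp b f D ε) (i, a) (i, a') (i, a'') = chi D a a' a'' := by
  have e : orient (blowUp b f D ε (i, a)) (blowUp b f D ε (i, a')) (blowUp b f D ε (i, a'')) =
      ε ^ 4 * ((b (f i) 0 - b i 0) ^ 2 + (b (f i) 1 - b i 1) ^ 2) *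
        orient (D a) (D a') (D a'') := by
    simp only [blowUp, orient]; simp; ring
  have hpos := sq_add_sq_pos_of_ne hi.symm
  unfold chi
  rw [e, sgn_mul, sgn_pos (by positivity), one_mul]

theorem exists_isBlowUp [DecidableEq κ] [Finite κ] [Finite α] (hb : GenPos b) (hf : ∀ i, f i ≠ i)
    (hff : ∀ i, f (f i) ≠ i) (hD : ∀ c, D c 0 ≠ 0) (hx : ∀ a c, a ≠ c → D a 0 ≠ D c 0) :
    ∃ P, IsBlowUp b f D P := by
  have h1 : ∀ᶠ ε in 𝓝[>] (0 : ℝ), ∀ i j k a c e, i ≠ j → i ≠ k → j ≠ k →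
      chi (blowUp b f D ε) (i, a) (j, c) (k, e) = chi b i j k := by
    simp only [eventually_all]
    exact fun i j k a c e hij hik hjk => eventually_chi_blowUp_base hb hij hik hjk a c e
  have h2 : ∀ᶠ ε in 𝓝[>] (0 : ℝ), ∀ i j a a' c, i ≠ j →
      chi (blowUp b f D ε) (i, a) (i, a') (j, c) =
        sgn (D a' 0 - D a 0) * clusterSide b f D i j c := by
    simp only [eventually_all]
    exact fun i j a a' c hij => eventually_chi_blowUp_pair hb hf hff hD hx hij a a' c
  obtain ⟨ε, h1, h2, hε⟩ := (h1.and (h2.and self_mem_nhdsWithin)).exists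
  refine ⟨blowUp b f D ε, h1, h2, fun i => chi_blowUp_cluster (fun h => ?_) hε⟩
  refine hb i (f i) (f (f i)) (hf i).symm (hff i).symm (hf (f i)).symm ?_
  rw [h]; unfold orient; ring

end construction

/-- A vertical line bisecting an even number of points with distinct first coordinates. -/
theorem exists_bisecting_value {α : Type*} [Fintype α] {h : ℕ} (hcard : Fintype.card α = h + h)
    (x : α → ℝ) (hx : Function.Injective x) :
    ∃ t, (∀ a, x a - t ≠ 0) ∧ ∑ a, sgn (x a - t) = 0 := by
  classical
  rcases Nat.eq_zero_or_pos h with rfl | hh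
  · have : IsEmpty α := Fintype.card_eq_zero_iff.1 hcard
    exact ⟨0, fun a => isEmptyElim a, by simp⟩
  let s : Finset ℝ := Finset.univ.image x
  have hs : s.card = h + h := by
    rw [Finset.card_image_of_injective _ hx, Finset.card_univ, hcard]
  let g : Fin (h + h) ↪o ℝ := s.orderEmbOfFin hs
  let l : Fin (h + h) := ⟨h - 1, by omega⟩
  let r : Fin (h + h) := ⟨h, by omega⟩
  have hlr : g l < g r := g.lt_iff_lt.2 (Fin.mk_lt_mk.2 (by omega))
  have hlow : ∀ k : Fin (h + h), (k : ℕ) < h → g k < (g l + g r) / 2 := by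
    intro k hk
    have : g k ≤ g l := g.le_iff_le.2 (Fin.mk_le_mk.2 (by omega))
    linarith
  have hhigh : ∀ k : Fin (h + h), h ≤ (k : ℕ) → (g l + g r) / 2 < g k := by
    intro k hk
    have : g r ≤ g k := g.le_iff_le.2 (Fin.mk_le_mk.2 hk)
    linarith
  have hsum : ∑ a, sgn (x a - (g l + g r) / 2) = ∑ k, sgn (g k - (g l + g r) / 2) := by
    have e1 : ∑ y ∈ s, sgn (y - (g l + g r) / 2) = ∑ a, sgn (x a - (g l + g r) / 2) :=
      Finset.sum_image fun a _ c _ hac => hx hac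
    rw [← e1, ← Finset.image_orderEmbOfFin_univ s hs, Finset.sum_image]
    exact fun a _ c _ hac => (s.orderEmbOfFin hs).injective hac
  refine ⟨(g l + g r) / 2, fun a => ?_, ?_⟩
  · have : x a ∈ Set.range g := by
      rw [Finset.range_orderEmbOfFin]; simp [s]
    obtain ⟨k, hk⟩ := this
    rw [← hk]
    rcases lt_or_ge (k : ℕ) h with hkh | hkh
    · exact (sub_neg.2 (hlow k hkh)).ne
    · exact (sub_pos.2 (hhigh k hkh)).ne'
  · rw [hsum, Fin.sum_univ_add]
    rw [Finset.sum_congr rfl fun k _ => sgn_neg (sub_neg.2 (hlow (Fin.castAdd h k) (by simp))),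
      Finset.sum_congr rfl fun k _ => sgn_pos (sub_pos.2 (hhigh (Fin.natAdd h k) (by simp)))]
    simp

/-! ### The six-point pattern -/

/-- Six points with three crossings, the fewest possible: the vertices `0`, `2`, `5` of the inner
triangle lie inside the outer triangle `1`, `3`, `4`. -/
noncomputable def sixPoints : Fin 6 → EuclideanSpace ℝ (Fin 2) := fun i =>
  !₂[((![1, 4, 3, 2, 0, 2] i : ℤ) : ℝ), ((![3, 4, 3, 0, 4, 1] i : ℤ) : ℝ)]

/-- A choice, for each of the six points, of a second point such that the line through the two
halves the remaining four. -/
def sixTarget : Fin 6 → Fin 6 := ![2, 2, 5, 5, 0, 0]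

/-- The orientation of three of the six points, over the integers. -/
def sixOrient (i j k : Fin 6) : ℤ :=
  ((![1, 4, 3, 2, 0, 2] j : ℤ) - ![1, 4, 3, 2, 0, 2] i) *
      ((![3, 4, 3, 0, 4, 1] k : ℤ) - ![3, 4, 3, 0, 4, 1] i) -
    ((![3, 4, 3, 0, 4, 1] j : ℤ) - ![3, 4, 3, 0, 4, 1] i) *
      ((![1, 4, 3, 2, 0, 2] k : ℤ) - ![1, 4, 3, 2, 0, 2] i)

theorem orient_sixPoints (i j k : Fin 6) :
    orient (sixPoints i) (sixPoints j) (sixPoints k) = (sixOrient i j k : ℝ) := by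
  simp only [orient, sixPoints, sixOrient]
  push_cast
  rfl

theorem genPos_sixPoints : GenPos sixPoints := by
  have : ∀ i j k : Fin 6, i ≠ j → i ≠ k → j ≠ k → sixOrient i j k ≠ 0 := by decide
  intro i j k hij hik hjk
  rw [orient_sixPoints]
  exact_mod_cast this i j k hij hik hjk

theorem chi_sixPoints (i j k : Fin 6) : chi sixPoints i j k = (sixOrient i j k).sign := by
  rw [chi, orient_sixPoints, sgn_intCast]

theorem defect_sixPoints (i : Fin 6) : defect sixPoints i (sixTarget i) = 0 := by
  unfold defect
  simp only [chi_sixPoints]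
  revert i
  decide

theorem energy_sixPoints : energy sixPoints = 144 := by
  unfold energy defect
  simp only [chi_sixPoints]
  decide

/-! ### The recursion for the rectilinear crossing number -/

theorem collinear_of_orient_eq_zero {a b c : EuclideanSpace ℝ (Fin 2)} (hab : a ≠ b)
    (h : orient a b c = 0) : Collinear ℝ {a, b, c} := by
  have hpos := (sq_add_sq_pos_of_ne hab).ne'
  rw [collinear_iff_of_mem (p₀ := a) (by simp)]
  refine ⟨b - a, fun p hp => ?_⟩
  rcases hp with rfl | rfl | rfl
  · exact ⟨0, by simp⟩
  · exact ⟨1, by simp⟩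
  · refine ⟨((b 0 - a 0) * (p 0 - a 0) + (b 1 - a 1) * (p 1 - a 1)) /
      ((b 0 - a 0) ^ 2 + (b 1 - a 1) ^ 2), ?_⟩
    unfold orient at h
    ext t
    fin_cases t
    · simp
      field_simp
      linear_combination -(b 1 - a 1) * h
    · simp
      field_simp
      linear_combination (b 0 - a 0) * h

theorem IsRectilinearDrawing.genPos {n : ℕ} {q : Fin n → EuclideanSpace ℝ (Fin 2)}
    (hq : IsRectilinearDrawing q) : GenPos q := fun i j k hij hik hjk h =>
  hq.not_collinear i j k hij hik hjk
    (collinear_of_orient_eq_zero (fun e => hij (hq.injective e)) h)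

/-- Points on a parabola. -/
theorem exists_genPos (n : ℕ) : ∃ p : Fin n → EuclideanSpace ℝ (Fin 2), GenPos p := by
  refine ⟨fun i => !₂[((i : ℕ) : ℝ), ((i : ℕ) : ℝ) ^ 2], fun i j k hij hik hjk => ?_⟩
  have h : ∀ {u v : Fin n}, u ≠ v → ((v : ℕ) : ℝ) - ((u : ℕ) : ℝ) ≠ 0 := by
    intro u v huv h0
    apply huv
    have := sub_eq_zero.1 h0
    exact (Fin.ext (by exact_mod_cast this)).symm
  have e : orient (!₂[((i : ℕ) : ℝ), ((i : ℕ) : ℝ) ^ 2]) (!₂[((j : ℕ) : ℝ), ((j : ℕ) : ℝ) ^ 2])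
      (!₂[((k : ℕ) : ℝ), ((k : ℕ) : ℝ) ^ 2]) =
      (((j : ℕ) : ℝ) - ((i : ℕ) : ℝ)) * (((k : ℕ) : ℝ) - ((i : ℕ) : ℝ)) *
        (((k : ℕ) : ℝ) - ((j : ℕ) : ℝ)) := by
    simp only [orient]; simp; ring
  rw [e]
  exact mul_ne_zero (mul_ne_zero (h hij) (h hik)) (h hjk)

theorem crossCount_congr {ι : Type*} [Fintype ι] {p q : ι → EuclideanSpace ℝ (Fin 2)}
    (h : ∀ i j k, chi q i j k = chi p i j k) : crossCount q = crossCount p := by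
  unfold crossCount Cross
  simp only [h]

theorem crossCount_comp_equiv {ι ι' : Type*} [Fintype ι] [Fintype ι'] (e : ι' ≃ ι)
    (p : ι → EuclideanSpace ℝ (Fin 2)) : crossCount (p ∘ e) = crossCount p := by
  have h : ∀ x y z w, Cross (p ∘ e) x y z w ↔ Cross p (e x) (e y) (e z) (e w) :=
    fun x y z w => Iff.rfl
  unfold crossCount
  simp only [h]
  rw [← e.sum_comp]
  refine Finset.sum_congr rfl fun x _ => ?_
  rw [← e.sum_comp]
  refine Finset.sum_congr rfl fun y _ => ?_
  rw [← e.sum_comp]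
  refine Finset.sum_congr rfl fun z _ => ?_
  rw [← e.sum_comp]

theorem eight_mul_rectilinearCrossingNumber_le {ι : Type*} [Fintype ι]
    {p : ι → EuclideanSpace ℝ (Fin 2)} (hp : GenPos p) {n : ℕ} (hn : Fintype.card ι = n) :
    (8 * rectilinearCrossingNumber n : ℤ) ≤ crossCount p := by
  let e : Fin n ≃ ι := (Fintype.equivFinOfCardEq hn).symm
  have hpe : GenPos (p ∘ e) := fun i j k hij hik hjk =>
    hp _ _ _ (e.injective.ne hij) (e.injective.ne hik) (e.injective.ne hjk)
  obtain ⟨q, hq, hdraw, -⟩ := hpe.exists_drawing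
  rw [← crossCount_comp_equiv e, ← crossCount_congr hq, ← eight_mul_crossings hdraw.genPos]
  have : rectilinearCrossingNumber n ≤ crossings q := Nat.sInf_le ⟨q, hdraw, rfl⟩
  exact_mod_cast Nat.mul_le_mul_left 8 this

/-- An optimal drawing, perturbed so that its vertices have distinct first coordinates. -/
theorem exists_crossCount_eq (n : ℕ) : ∃ q : Fin n → EuclideanSpace ℝ (Fin 2), GenPos q ∧
    (∀ i j, i ≠ j → q i 0 ≠ q j 0) ∧ crossCount q = 8 * rectilinearCrossingNumber n := by
  have hne : {c : ℕ | ∃ p : Fin n → EuclideanSpace ℝ (Fin 2),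
      IsRectilinearDrawing p ∧ crossings p = c}.Nonempty := by
    obtain ⟨p, hp⟩ := exists_genPos n
    obtain ⟨q, -, hq, -⟩ := hp.exists_drawing
    exact ⟨_, q, hq, rfl⟩
  obtain ⟨p, hp, hc⟩ := Nat.sInf_mem hne
  obtain ⟨q, hq, -, hx⟩ := hp.genPos.exists_drawing
  refine ⟨q, hp.genPos.of_chi_eq hq, hx, ?_⟩
  rw [crossCount_congr hq, ← eight_mul_crossings hp.genPos, hc]
  rfl

/-- Blowing up the six-point pattern with an optimal drawing of `K_m`. The parity of `m` allows the
lines of one cluster to bisect another cluster exactly. -/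
theorem rectilinearCrossingNumber_six_mul_le {m : ℕ} (hm : Even m) :
    (24 * rectilinearCrossingNumber (6 * m) : ℤ) ≤
      144 * rectilinearCrossingNumber m + 492 * (m : ℤ) ^ 4 + 18 * (m : ℤ) ^ 3 := by
  obtain ⟨h, hh⟩ := hm
  obtain ⟨q, hq, hx, hc⟩ := exists_crossCount_eq m
  obtain ⟨t, ht, ht0⟩ := exists_bisecting_value (by rw [Fintype.card_fin, hh]) (fun a => q a 0)
    (fun a c hac => by by_contra hne; exact hx a c hne hac)
  let D : Fin m → EuclideanSpace ℝ (Fin 2) := fun a => !₂[q a 0 - t, q a 1]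
  have hchi : ∀ i j k, chi D i j k = chi q i j k := by
    intro i j k
    simp only [chi, D, orient]
    simp
  have hD : GenPos D := hq.of_chi_eq hchi
  have hD1 : ∀ c, D c 0 ≠ 0 := fun c => by simpa [D] using ht c
  have hD2 : ∑ c, sgn (D c 0) = 0 := by simpa [D] using ht0
  have hDx : ∀ a c, a ≠ c → D a 0 ≠ D c 0 := fun a c hac => by simpa [D] using hx a c hac
  have hf : ∀ i, sixTarget i ≠ i := by decide
  have hff : ∀ i, sixTarget (sixTarget i) ≠ i := by decide
  obtain ⟨P, hP⟩ := exists_isBlowUp genPos_sixPoints hf hff hD1 hDx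
  have hPg := hP.genPos genPos_sixPoints hf hff hD1 hDx hD
  have hE := hP.energy_le genPos_sixPoints hf hff hD1 hD2 defect_sixPoints
  have h1 := eight_mul_rectilinearCrossingNumber_le hPg (n := 6 * m) (by simp)
  rw [crossCount_eq_energy P hPg] at h1
  have h2 := crossCount_eq_energy D hD
  rw [crossCount_congr hchi, hc] at h2
  rw [energy_sixPoints] at hE
  simp only [Fintype.card_prod, Fintype.card_fin, Nat.cast_mul, Nat.cast_ofNat] at h1 h2 hE
  have h3 : (m : ℤ) * (m - 1) * (m - 2) ≤ (m : ℤ) ^ 3 := by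
    nlinarith [Int.le_self_sq (m : ℤ)]
  have h4 : 0 ≤ 6 * (m : ℤ) * (6 * m - 1) * (6 * m - 2) := by
    rcases Nat.eq_zero_or_pos m with h0 | h0
    · simp [h0]
    · have : (1 : ℤ) ≤ m := by exact_mod_cast h0
      have a1 : (0 : ℤ) ≤ 6 * m - 1 := by linarith
      have a2 : (0 : ℤ) ≤ 6 * m - 2 := by linarith
      positivity
  linarith

/-! ### Deleting a vertex -/

theorem sum_ite_ne_quadruple {V : Type*} [Fintype V] [DecidableEq V] {x y z w : V}
    (h : x ≠ y ∧ x ≠ z ∧ x ≠ w ∧ y ≠ z ∧ y ≠ w ∧ z ≠ w) :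
    ∑ v, (if x = v then 0 else if y = v then 0 else if z = v then 0 else if w = v then 0 else 1 : ℤ)
      = Fintype.card V - 4 := by
  obtain ⟨hxy, hxz, hxw, hyz, hyw, hzw⟩ := h
  have : ∀ v, (if x = v then 0 else if y = v then 0 else if z = v then 0 else if w = v then 0
      else 1 : ℤ) = 1 - (if x = v then 1 else 0) - (if y = v then 1 else 0)
        - (if z = v then 1 else 0) - (if w = v then 1 else 0) := by
    intro v
    by_cases h1 : x = v
    · subst h1; simp [hxy.symm, hxz.symm, hxw.symm]
    by_cases h2 : y = v
    · subst h2; simp [hyz.symm, hyw.symm, hxy]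
    by_cases h3 : z = v
    · subst h3; simp [hzw.symm, hxz, hyz]
    by_cases h4 : w = v <;> simp [*]
  simp only [this, Finset.sum_sub_distrib, Finset.sum_ite_eq, Finset.mem_univ, if_true,
    Finset.sum_const, Finset.card_univ, nsmul_eq_mul, mul_one]
  ring

theorem sum_succAbove {n : ℕ} (g : Fin (n + 1) → ℤ) (v : Fin (n + 1)) :
    ∑ i, g (v.succAbove i) = ∑ x, if x = v then 0 else g x := by
  rw [Fin.sum_univ_succAbove _ v]
  simp [Fin.succAbove_ne]

/-- Every crossing survives the deletion of a vertex, except for its own four vertices. -/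
theorem sum_crossCount_succAbove {n : ℕ} (q : Fin (n + 1) → EuclideanSpace ℝ (Fin 2)) :
    ∑ v : Fin (n + 1), crossCount (q ∘ v.succAbove) = ((n : ℤ) - 3) * crossCount q := by
  have h : ∀ v : Fin (n + 1), crossCount (q ∘ v.succAbove) = ∑ x, ∑ y, ∑ z, ∑ w,
      (if x = v then 0 else if y = v then 0 else if z = v then 0 else if w = v then 0 else 1) *
        (if Cross q x y z w then 1 else 0) := by
    intro v
    have e : crossCount (q ∘ v.succAbove) = ∑ x, ∑ y, ∑ z, ∑ w,
        if Cross q (v.succAbove x) (v.succAbove y) (v.succAbove z) (v.succAbove w) then 1 else 0 :=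
      rfl
    rw [e, sum_succAbove (fun a => ∑ y, ∑ z, ∑ w,
      if Cross q a (v.succAbove y) (v.succAbove z) (v.succAbove w) then 1 else 0)]
    refine Finset.sum_congr rfl fun x _ => ?_
    by_cases hx : x = v
    · simp [hx]
    rw [if_neg hx, sum_succAbove (fun a => ∑ z, ∑ w,
      if Cross q x a (v.succAbove z) (v.succAbove w) then 1 else 0)]
    refine Finset.sum_congr rfl fun y _ => ?_
    by_cases hy : y = v
    · simp [hy]
    rw [if_neg hy, sum_succAbove (fun a => ∑ w, if Cross q x y a (v.succAbove w) then 1 else 0)]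
    refine Finset.sum_congr rfl fun z _ => ?_
    by_cases hz : z = v
    · simp [hz]
    rw [if_neg hz, sum_succAbove (fun a => if Cross q x y z a then 1 else 0)]
    refine Finset.sum_congr rfl fun w _ => ?_
    by_cases hw : w = v <;> simp [hx, hy, hz, hw]
  simp only [h]
  rw [Finset.sum_comm]
  unfold crossCount
  rw [Finset.mul_sum]
  refine Finset.sum_congr rfl fun x _ => ?_
  rw [Finset.sum_comm, Finset.mul_sum]
  refine Finset.sum_congr rfl fun y _ => ?_
  rw [Finset.sum_comm, Finset.mul_sum]
  refine Finset.sum_congr rfl fun z _ => ?_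
  rw [Finset.sum_comm, Finset.mul_sum]
  refine Finset.sum_congr rfl fun w _ => ?_
  by_cases hc : Cross q x y z w
  · simp only [if_pos hc, mul_one]
    rw [sum_ite_ne_quadruple hc.distinct, Fintype.card_fin]
    push_cast
    ring
  · simp [hc]

theorem succ_mul_rectilinearCrossingNumber_le (n : ℕ) :
    ((n : ℤ) + 1) * rectilinearCrossingNumber n ≤
      ((n : ℤ) - 3) * rectilinearCrossingNumber (n + 1) := by
  obtain ⟨q, hq, -, hc⟩ := exists_crossCount_eq (n + 1)
  have h := sum_crossCount_succAbove q
  have hle : ∑ _v : Fin (n + 1), (8 * rectilinearCrossingNumber n : ℤ) ≤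
      ∑ v : Fin (n + 1), crossCount (q ∘ v.succAbove) := by
    refine Finset.sum_le_sum fun v _ => ?_
    refine eight_mul_rectilinearCrossingNumber_le (fun i j k hij hik hjk => ?_) (Fintype.card_fin n)
    exact hq _ _ _ (Fin.succAbove_right_injective.ne hij) (Fin.succAbove_right_injective.ne hik)
      (Fin.succAbove_right_injective.ne hjk)
  rw [h, hc] at hle
  simp at hle
  linarith

/-! ### The limit -/

theorem crossCount_le {ι : Type*} [Fintype ι] (p : ι → EuclideanSpace ℝ (Fin 2)) :
    crossCount p ≤ (Fintype.card ι : ℤ) ^ 4 := by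
  calc crossCount p ≤ ∑ _x : ι, ∑ _y : ι, ∑ _z : ι, ∑ _w : ι, (1 : ℤ) := by
        refine Finset.sum_le_sum fun x _ => Finset.sum_le_sum fun y _ =>
          Finset.sum_le_sum fun z _ => Finset.sum_le_sum fun w _ => ?_
        split_ifs <;> norm_num
    _ = _ := by simp; ring

theorem rectilinearCrossingNumber_le_pow (n : ℕ) :
    (rectilinearCrossingNumber n : ℝ) ≤ (n : ℝ) ^ 4 := by
  obtain ⟨q, -, -, hc⟩ := exists_crossCount_eq n
  have h := crossCount_le q
  rw [hc, Fintype.card_fin] at h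
  have h' : (8 * rectilinearCrossingNumber n : ℝ) ≤ (n : ℝ) ^ 4 := by exact_mod_cast h
  have : (0 : ℝ) ≤ rectilinearCrossingNumber n := by positivity
  linarith

theorem tendsto_choose_four_div_pow :
    Tendsto (fun n : ℕ => (n.choose 4 : ℝ) / (n : ℝ) ^ 4) atTop (𝓝 (1 / 24)) := by
  have h := ProbabilityTheory.tendsto_choose_mul_pow_atTop (p := fun n => 1 / (n : ℝ)) (r := 1) 4
    (tendsto_const_nhds.congr' (by
      filter_upwards [eventually_gt_atTop 0] with n hn
      have : (n : ℝ) ≠ 0 := by positivity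
      field_simp))
  have e : (1 : ℝ) ^ 4 / (Nat.factorial 4 : ℕ) = 1 / 24 := by norm_num [Nat.factorial]
  rw [e] at h
  refine h.congr fun n => ?_
  rw [div_pow, one_pow, mul_one_div]

/-- The proportion of crossing quadruples does not decrease with the number of vertices, since an
optimal drawing has drawings with one vertex fewer inside it. -/
theorem exists_tendsto_rectilinearCrossingNumber : ∃ L : ℝ,
    Tendsto (fun n : ℕ => (rectilinearCrossingNumber n : ℝ) / (n.choose 4 : ℝ)) atTop (𝓝 L) := by
  set a : ℕ → ℝ := fun n => (rectilinearCrossingNumber n : ℝ) / (n.choose 4 : ℝ) with ha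
  have hmono : Monotone fun k => a (k + 4) := by
    refine monotone_nat_of_le_succ fun k => ?_
    simp only [ha]
    set n := k + 4 with hn
    have hsucc : k + 1 + 4 = n + 1 := by omega
    rw [hsucc]
    have h1 : (0 : ℝ) < n.choose 4 := by exact_mod_cast Nat.choose_pos (by omega)
    have h2 : (0 : ℝ) < (n + 1).choose 4 := by exact_mod_cast Nat.choose_pos (by omega)
    have h3 : (n.choose 4 : ℝ) * (n + 1) = (n + 1).choose 4 * (n - 3) := by
      have := Nat.choose_mul_succ_eq n 4
      have e : n + 1 - 4 = k + 1 := by omega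
      rw [e] at this
      have hk : (n : ℝ) - 3 = k + 1 := by rw [hn]; push_cast; ring
      rw [hk]
      exact_mod_cast this
    have h4 : ((n : ℝ) + 1) * rectilinearCrossingNumber n ≤
        ((n : ℝ) - 3) * rectilinearCrossingNumber (n + 1) := by
      exact_mod_cast succ_mul_rectilinearCrossingNumber_le n
    have h5 : (0 : ℝ) < (n : ℝ) - 3 := by
      rw [hn]; push_cast
      have : (0 : ℝ) ≤ k := by positivity
      linarith
    rw [div_le_div_iff₀ h1 h2]
    refine le_of_mul_le_mul_right ?_ h5
    calc _ = ((n : ℝ) + 1) * rectilinearCrossingNumber n * n.choose 4 := by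
          linear_combination -(rectilinearCrossingNumber n : ℝ) * h3
      _ ≤ ((n : ℝ) - 3) * rectilinearCrossingNumber (n + 1) * n.choose 4 :=
          mul_le_mul_of_nonneg_right h4 h1.le
      _ = _ := by ring
  have hbdd : BddAbove (Set.range fun k => a (k + 4)) := by
    obtain ⟨B, hB⟩ := (tendsto_choose_four_div_pow.inv₀ (by norm_num)).bddAbove_range
    refine ⟨B, ?_⟩
    rintro _ ⟨k, rfl⟩
    refine le_trans ?_ (hB ⟨k + 4, rfl⟩)
    simp only [ha, inv_div]
    exact div_le_div_of_nonneg_right (rectilinearCrossingNumber_le_pow _) (by positivity)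
  exact ⟨_, (tendsto_add_atTop_iff_nat 4).1 (tendsto_atTop_ciSup hmono hbdd)⟩

/-- Dividing the recursion by `m ^ 4` turns it into `1296 * L ≤ 6 * L + 492`. -/
theorem limit_le {L : ℝ}
    (hL : Tendsto (fun n : ℕ => (rectilinearCrossingNumber n : ℝ) / (n.choose 4 : ℝ)) atTop (𝓝 L)) :
    L ≤ 82 / 215 := by
  have hq : Tendsto (fun n : ℕ => (rectilinearCrossingNumber n : ℝ) / (n : ℝ) ^ 4) atTop
      (𝓝 (L * (1 / 24))) := by
    refine (hL.mul tendsto_choose_four_div_pow).congr' ?_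
    filter_upwards [eventually_ge_atTop 4] with n hn
    have : (n.choose 4 : ℝ) ≠ 0 := by exact_mod_cast (Nat.choose_pos hn).ne'
    field_simp
  have h2 : Tendsto (fun k : ℕ => 2 * k) atTop atTop :=
    tendsto_id.const_mul_atTop' (by norm_num)
  have h12 : Tendsto (fun k : ℕ => 6 * (2 * k)) atTop atTop := h2.const_mul_atTop' (by norm_num)
  have hinv : Tendsto (fun k : ℕ => 18 * (((2 * k : ℕ) : ℝ))⁻¹) atTop (𝓝 (18 * 0)) :=
    ((tendsto_inv_atTop_nhds_zero_nat (𝕜 := ℝ)).comp h2).const_mul 18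
  have hlim := le_of_tendsto_of_tendsto ((hq.comp h12).const_mul (24 * 1296))
    ((((hq.comp h2).const_mul 144).add_const 492).add hinv) (by
      filter_upwards [eventually_gt_atTop 0] with k hk
      have hrec := rectilinearCrossingNumber_six_mul_le (m := 2 * k) (even_two_mul k)
      have hrec' : (24 * rectilinearCrossingNumber (6 * (2 * k)) : ℝ) ≤
          144 * rectilinearCrossingNumber (2 * k) + 492 * ((2 * k : ℕ) : ℝ) ^ 4
            + 18 * ((2 * k : ℕ) : ℝ) ^ 3 := by exact_mod_cast hrec
      have hpos : (0 : ℝ) < ((2 * k : ℕ) : ℝ) := by exact_mod_cast (by omega : 0 < 2 * k)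
      simp only [Function.comp_apply]
      have e1 : (24 * 1296 : ℝ) * ((rectilinearCrossingNumber (6 * (2 * k)) : ℝ) /
          ((6 * (2 * k) : ℕ) : ℝ) ^ 4) =
          24 * rectilinearCrossingNumber (6 * (2 * k)) / ((2 * k : ℕ) : ℝ) ^ 4 := by
        rw [Nat.cast_mul 6, mul_pow]
        push_cast
        field_simp
        norm_num
        ring
      rw [e1, div_le_iff₀ (by positivity)]
      refine hrec'.trans (le_of_eq ?_)
      field_simp)
  linarith

theorem theorem1 :
    ∃ L : ℝ,
      Tendsto (fun n : ℕ => (rectilinearCrossingNumber n : ℝ) / (n.choose 4 : ℝ)) atTop (𝓝 L) ∧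
      L ≤ 6467 / 16848 := by
  obtain ⟨L, hL⟩ := exists_tendsto_rectilinearCrossingNumber
  exact ⟨L, hL, (limit_le hL).trans (by norm_num)⟩
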